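/- **Theorem.** Let $\omega>0$, $T=\frac{2\pi}{\omega}$, $\gamma\in\mathbb R\setminus\{0\}$, let $\mathbb T_T$ be the torus of length $T$, and let $g\in L^\infty(\mathbb R)$ be real-valued, even and not (a.e.) identically zero. For odd $k\in\mathbb N$ let $$L_k=-\frac{d^2}{dx^2}-k^2\omega^2 g(x)\colon H^2(\mathbb R)\subset L^2(\mathbb R)\to L^2(\mathbb R),$$ let $\sigma_{\mathrm{ess}}(L_k)$ be its essential spectrum (the spectrum without the isolated eigenvalues of finite multiplicity), and let $\sigma_D(L_k)$ be the spectrum of $L_k$ with an extra Dirichlet condition at $0$, that is, the spectrum of the restriction of $L_k$ to odd functions, as an operator in the space of odd $L^2$-functions. Assume $$0\notin\sigma_{\mathrm{ess}}(L_k)\cup\sigma_D(L_k)\qquad\text{for every odd } k\in\mathbb N .$$ For odd $k\in\mathbb N$ let $\Phi_k\in H^2(0,\infty)$ be the (real) function with $-\Phi_k''-k^2\omega^2 g\,\Phi_k=0$ on $(0,\infty)$ and $\Phi_k(0)=1$; it exists and is unique under these assumptions. Assume that there are $\rho,M>0$ such that $|\Phi_k(x)|\le M e^{-\rho x}$ for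 all $x\ge 0$ and all odd $k\in\mathbb N$. Assume finally that either (i) $\gamma<0$ and $\Phi_k'(0)>0$ for at least one odd $k\in\mathbb N$, or (ii) $\gamma>0$ and $\Phi_k'(0)<0$ for at least one odd $k\in\mathbb N$. Then the equation $$g(x)\,w_{tt}-w_{xx}+\gamma\,\delta_0(x)\,(w_t^3)_t=0,\qquad (x,t)\in\mathbb R\times\mathbb R,$$ has a nontrivial, real-valued, $T$-periodic (in $t$) weak solution $w$, and there is a constant $C>0$ such that $|w(x,t)|\le C e^{-\rho|x|}$ for all $(x,t)\in\mathbb R^2$, with the same $\rho$. Here a weak solution is a function $w\in H^1(\mathbb R\times\mathbb T_T)$ whose trace $w(0,\cdot)$ at $x=0$ has a weak derivative $\partial_t w(0,\cdot)\in L^3(\mathbb T_T)$ and which satisfies, for every $\psi\in C_c^\infty(\mathbb R\times\mathbb T_T)$, $$\int_{\mathbb R\times\mathbb T_T}\bigl(-g(x)\,\partial_t w\,\partial_t\psi+\partial_x w\,\partial_x\psi\bigr)\,d(x,t)-\gamma\int_0^T(\partial_t w(0,t))^3\,\partial_t\psi(0,t)\,dt=0 .$$ -/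

import Mathlib

open Set Filter MeasureTheory
open scoped ENNReal

namespace Breather

noncomputable section

/-! ### Sobolev functions of order two on an interval -/

/-- For an interval `s` (used for `ℝ` and for `[0, ∞)`): `φ` is the `C¹` representative of an element
of the Sobolev space `H²` of the interior of `s`, with first and second weak derivatives `φ'` and
`φ''`. In one dimension this means that `φ`, `φ'`, `φ''` are square integrable and that `φ` and
`φ'` are the (locally absolutely continuous) primitives of `φ'` and `φ''`. -/
structure HasH2Derivs {E : Type*} [NormedAddCommGroup E] [NormedSpace ℝ E] (s : Set ℝ)
    (φ φ' φ'' : ℝ → E) : Prop where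
  memLp : MemLp φ 2 (volume.restrict s)
  memLp_fst : MemLp φ' 2 (volume.restrict s)
  memLp_snd : MemLp φ'' 2 (volume.restrict s)
  integral_fst : ∀ a ∈ s, ∀ b ∈ s, φ b - φ a = ∫ x in a..b, φ' x
  integral_snd : ∀ a ∈ s, ∀ b ∈ s, φ' b - φ' a = ∫ x in a..b, φ'' x

/-! ### Spectra of unbounded operators -/

section Spectrum

variable {E : Type*} [NormedAddCommGroup E] [NormedSpace ℂ E]

/-- The resolvent set of an unbounded operator `A`: all `z` such that `A - z` is a bijection from
the domain of `A` onto the whole space with bounded inverse. -/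
def resolventSet (A : E →ₗ.[ℂ] E) : Set ℂ :=
  {z | Function.Bijective (fun u : A.domain => A u - z • (u : E)) ∧
    ∃ C : ℝ, ∀ u : A.domain, ‖(u : E)‖ ≤ C * ‖A u - z • (u : E)‖}

/-- The spectrum of an unbounded operator. -/
def spectrum (A : E →ₗ.[ℂ] E) : Set ℂ := (resolventSet A)ᶜ

/-- The eigenspace `{u ∈ dom A | A u = z u}`. -/
def eigenspace (A : E →ₗ.[ℂ] E) (z : ℂ) : Submodule ℂ E :=
  A.graph.comap (LinearMap.prod LinearMap.id (z • LinearMap.id))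

/-- The discrete spectrum (of a self-adjoint operator): the isolated points of the spectrum that
are eigenvalues of finite multiplicity. -/
def discreteSpectrum (A : E →ₗ.[ℂ] E) : Set ℂ :=
  {z | z ∈ spectrum A ∧ (∃ ε > 0, ∀ y ∈ spectrum A, dist y z < ε → y = z) ∧
    eigenspace A z ≠ ⊥ ∧ FiniteDimensional ℂ (eigenspace A z)}

/-- The essential spectrum (of a self-adjoint operator): the complement of the discrete spectrum in
the spectrum. -/
def essentialSpectrum (A : E →ₗ.[ℂ] E) : Set ℂ := spectrum A \ discreteSpectrum A

end Spectrum

/-! ### The operators `L_k` -/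

/-- The complex Hilbert space `L²(ℝ)`. -/
abbrev L2 : Type := Lp ℂ 2 (volume : Measure ℝ)

/-- The graph of `- d²/dx² - κ g` with domain `H²(ℝ)` in `L²(ℝ)`. -/
def schrodingerGraph (g : ℝ → ℝ) (κ : ℝ) : Submodule ℂ (L2 × L2) where
  carrier := {p | ∃ φ φ' φ'' : ℝ → ℂ, HasH2Derivs univ φ φ' φ'' ∧ p.1 =ᵐ[volume] φ ∧
    p.2 =ᵐ[volume] fun x => -φ'' x - ((κ * g x : ℝ) : ℂ) * φ x}
  zero_mem' := by
    refine ⟨0, 0, 0, ⟨MemLp.zero, MemLp.zero, MemLp.zero, by simp, by simp⟩, ?_, ?_⟩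
    · exact Lp.coeFn_zero _ _ _
    · filter_upwards [Lp.coeFn_zero ℂ 2 (volume : Measure ℝ)] with x _
      simp
  add_mem' := by
    rintro p q ⟨φ, φ', φ'', h, hp, hp'⟩ ⟨χ, χ', χ'', k, hq, hq'⟩
    have int : ∀ {f : ℝ → ℂ}, MemLp f 2 (volume.restrict univ) → ∀ a b : ℝ,
        IntervalIntegrable f volume a b := fun {f} hf a b => by
      rw [Measure.restrict_univ] at hf
      exact ((hf.locallyIntegrable (by norm_num)).integrableOn_isCompact
        isCompact_uIcc).intervalIntegrable
    refine ⟨φ + χ, φ' + χ', φ'' + χ'', ⟨h.memLp.add k.memLp, h.memLp_fst.add k.memLp_fst,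
      h.memLp_snd.add k.memLp_snd, ?_, ?_⟩, ?_, ?_⟩
    · intro a ha b hb
      have e := intervalIntegral.integral_add (int h.memLp_fst a b) (int k.memLp_fst a b)
      simp only [Pi.add_apply]
      rw [e, ← h.integral_fst a ha b hb, ← k.integral_fst a ha b hb]
      ring
    · intro a ha b hb
      have e := intervalIntegral.integral_add (int h.memLp_snd a b) (int k.memLp_snd a b)
      simp only [Pi.add_apply]
      rw [e, ← h.integral_snd a ha b hb, ← k.integral_snd a ha b hb]
      ring
    · filter_upwards [Lp.coeFn_add p.1 q.1, hp, hq] with x h1 h2 h3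
      exact h1.trans (by simp [h2, h3])
    · filter_upwards [Lp.coeFn_add p.2 q.2, hp', hq'] with x h1 h2 h3
      simp only [Prod.snd_add, h1, Pi.add_apply, h2, h3]
      ring
  smul_mem' := by
    rintro c p ⟨φ, φ', φ'', h, hp, hp'⟩
    refine ⟨c • φ, c • φ', c • φ'', ⟨h.memLp.const_smul c, h.memLp_fst.const_smul c,
      h.memLp_snd.const_smul c, ?_, ?_⟩, ?_, ?_⟩
    · intro a ha b hb
      simp only [Pi.smul_apply]
      rw [intervalIntegral.integral_smul, ← h.integral_fst a ha b hb, smul_sub]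
    · intro a ha b hb
      simp only [Pi.smul_apply]
      rw [intervalIntegral.integral_smul, ← h.integral_snd a ha b hb, smul_sub]
    · filter_upwards [Lp.coeFn_smul c p.1, hp] with x h1 h2
      simp [h1, h2]
    · filter_upwards [Lp.coeFn_smul c p.2, hp'] with x h1 h2
      simp only [Prod.smul_snd, h1, Pi.smul_apply, h2, smul_eq_mul]
      ring

/-- The relation `schrodingerGraph` is the graph of a (single-valued) operator. -/
theorem schrodingerGraph_single_valued (g : ℝ → ℝ) (κ : ℝ) (p : L2 × L2)
    (hp : p ∈ schrodingerGraph g κ) (h0 : p.1 = 0) : p.2 = 0 := by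
  -- a function in `L²(ℝ)` all of whose integrals vanish is zero almost everywhere
  have key : ∀ {f : ℝ → ℂ}, MemLp f 2 (volume.restrict univ) →
      (∀ a b : ℝ, ∫ x in a..b, f x = 0) → f =ᵐ[volume] 0 := by
    intro f hf h
    rw [Measure.restrict_univ] at hf
    have hloc : LocallyIntegrable f volume := hf.locallyIntegrable (by norm_num)
    filter_upwards [LocallyIntegrable.ae_hasDerivAt_integral hloc] with x hx
    have h1 := hx 0
    have h2 : (fun b => ∫ y in (0 : ℝ)..b, f y) = fun _ => 0 := funext fun b => h 0 b
    rw [h2] at h1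
    exact h1.unique (hasDerivAt_const x 0)
  have cont : ∀ {u v : ℝ → ℂ}, MemLp v 2 (volume.restrict univ) →
      (∀ a ∈ (univ : Set ℝ), ∀ b ∈ (univ : Set ℝ), u b - u a = ∫ x in a..b, v x) →
      Continuous u := by
    intro u v hv h
    rw [Measure.restrict_univ] at hv
    have hloc : LocallyIntegrable v volume := hv.locallyIntegrable (by norm_num)
    have hc := intervalIntegral.continuous_primitive
      (fun a b => (hloc.integrableOn_isCompact
        (isCompact_uIcc (a := a) (b := b))).intervalIntegrable) 0
    have hu : u = fun b => u 0 + ∫ x in (0 : ℝ)..b, v x := by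
      funext b
      rw [← h 0 (mem_univ _) b (mem_univ _)]
      ring
    rw [hu]
    exact continuous_const.add hc
  obtain ⟨φ, φ', φ'', h, hp1, hp2⟩ := hp
  have hφ0 : φ =ᵐ[volume] 0 := by
    rw [h0] at hp1
    exact hp1.symm.trans (Lp.coeFn_zero _ _ _)
  have hφ : φ = 0 :=
    (Continuous.ae_eq_iff_eq volume (cont h.memLp_fst h.integral_fst) continuous_zero).1 hφ0
  have hφ'0 : φ' =ᵐ[volume] 0 := key h.memLp_fst fun a b => by
    rw [← h.integral_fst a (mem_univ _) b (mem_univ _), hφ]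
    simp
  have hφ' : φ' = 0 :=
    (Continuous.ae_eq_iff_eq volume (cont h.memLp_snd h.integral_snd) continuous_zero).1 hφ'0
  have hφ''0 : φ'' =ᵐ[volume] 0 := key h.memLp_snd fun a b => by
    rw [← h.integral_snd a (mem_univ _) b (mem_univ _), hφ']
    simp
  rw [Lp.eq_zero_iff_ae_eq_zero]
  filter_upwards [hp2, hφ''0] with x h1 h2
  rw [h1, h2, hφ]
  simp

/-- The subspace of odd functions in `L²(ℝ)`. -/
def oddL2 : Submodule ℂ L2 where
  carrier := {u | ∀ᵐ x : ℝ, u (-x) = -u x}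
  zero_mem' := by
    have h := Lp.coeFn_zero ℂ 2 (volume : Measure ℝ)
    filter_upwards [h, (Measure.measurePreserving_neg (volume : Measure ℝ)).quasiMeasurePreserving.ae h]
      with x h1 h2
    rw [h1, h2]
    simp
  add_mem' := by
    intro u v hu hv
    simp only [mem_ofPred_eq] at hu hv ⊢
    have h := Lp.coeFn_add u v
    filter_upwards [h, (Measure.measurePreserving_neg (volume : Measure ℝ)).quasiMeasurePreserving.ae h,
      hu, hv] with x h1 h2 h3 h4
    rw [h1, h2]
    simp only [Pi.add_apply, h3, h4]
    ring
  smul_mem' := by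
    intro c u hu
    simp only [mem_ofPred_eq] at hu ⊢
    have h := Lp.coeFn_smul c u
    filter_upwards [h, (Measure.measurePreserving_neg (volume : Measure ℝ)).quasiMeasurePreserving.ae h,
      hu] with x h1 h2 h3
    rw [h1, h2]
    simp only [Pi.smul_apply, h3, smul_neg]

/-- The operator `L_k = - d²/dx² - k² ω² g` in `L²(ℝ)` with domain `H²(ℝ)`. -/
def operatorL (g : ℝ → ℝ) (ω : ℝ) (k : ℕ) : L2 →ₗ.[ℂ] L2 :=
  (schrodingerGraph g ((k : ℝ) ^ 2 * ω ^ 2)).toLinearPMap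

/-- The operator `L_k` with a Dirichlet condition at `0`, i.e. (for even `g`) the restriction of
`L_k` to odd functions, as an operator in the Hilbert space of odd functions. -/
def dirichletL (g : ℝ → ℝ) (ω : ℝ) (k : ℕ) : oddL2 →ₗ.[ℂ] oddL2 :=
  ((schrodingerGraph g ((k : ℝ) ^ 2 * ω ^ 2)).comap
    (oddL2.subtype.prodMap oddL2.subtype)).toLinearPMap

/-- The graph of `L_k`. -/
theorem operatorL_graph (g : ℝ → ℝ) (ω : ℝ) (k : ℕ) :
    (operatorL g ω k).graph = schrodingerGraph g ((k : ℝ) ^ 2 * ω ^ 2) :=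
  Submodule.toLinearPMap_graph_eq _ (schrodingerGraph_single_valued g _)

/-- The graph of the Dirichlet operator. -/
theorem dirichletL_graph (g : ℝ → ℝ) (ω : ℝ) (k : ℕ) :
    (dirichletL g ω k).graph = (schrodingerGraph g ((k : ℝ) ^ 2 * ω ^ 2)).comap
      (oddL2.subtype.prodMap oddL2.subtype) := by
  refine Submodule.toLinearPMap_graph_eq _ fun p hp h0 => ?_
  have h := schrodingerGraph_single_valued g _ _ (Submodule.mem_comap.1 hp) (by simp [h0])
  exact Subtype.ext h

/-- `φ` is the function `Φ_k`: it belongs to `H²(0, ∞)`, satisfies `L_k φ = 0` on `(0, ∞)`, and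
`φ(0) = 1`. (Only the values on `[0, ∞)` matter.) -/
def IsDecayingSolution (g : ℝ → ℝ) (ω : ℝ) (k : ℕ) (φ : ℝ → ℝ) : Prop :=
  (∃ φ' φ'' : ℝ → ℝ, HasH2Derivs (Ici 0) φ φ' φ'' ∧
    ∀ᵐ x ∂(volume.restrict (Ioi 0)), -φ'' x - (k : ℝ) ^ 2 * ω ^ 2 * g x * φ x = 0) ∧
  φ 0 = 1

/-! ### Weak solutions on `ℝ × 𝕋_T`

Functions on `ℝ × 𝕋_T` are functions of `(x, t) ∈ ℝ × ℝ` that are `T`-periodic in `t`; integrals are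
taken over the strip `ℝ × (0, T]`. -/

/-- The strip `ℝ × (0, T]`. -/
def strip (T : ℝ) : Set (ℝ × ℝ) := univ ×ˢ Ioc 0 T

/-- The partial derivative `∂ψ/∂x`. -/
def dx (ψ : ℝ × ℝ → ℝ) (p : ℝ × ℝ) : ℝ := fderiv ℝ ψ p (1, 0)

/-- The partial derivative `∂ψ/∂t`. -/
def dt (ψ : ℝ × ℝ → ℝ) (p : ℝ × ℝ) : ℝ := fderiv ℝ ψ p (0, 1)

/-- Test functions: smooth functions on `ℝ × 𝕋_T` with compact support. -/
structure IsTestFunction (T : ℝ) (ψ : ℝ × ℝ → ℝ) : Prop where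
  smooth : ContDiff ℝ (⊤ : ℕ∞) ψ
  periodic : ∀ x t, ψ (x, t + T) = ψ (x, t)
  compact : ∃ R : ℝ, ∀ x t, R < |x| → ψ (x, t) = 0

/-- `w` belongs to `H¹(ℝ × 𝕋_T)` and has the weak partial derivatives `wx` and `wt`. -/
structure HasH1Derivs (T : ℝ) (w wx wt : ℝ × ℝ → ℝ) : Prop where
  memLp : MemLp w 2 (volume.restrict (strip T))
  memLp_x : MemLp wx 2 (volume.restrict (strip T))
  memLp_t : MemLp wt 2 (volume.restrict (strip T))
  weak_x : ∀ ψ, IsTestFunction T ψ →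
    ∫ p in strip T, w p * dx ψ p = -∫ p in strip T, wx p * ψ p
  weak_t : ∀ ψ, IsTestFunction T ψ →
    ∫ p in strip T, w p * dt ψ p = -∫ p in strip T, wt p * ψ p

/-- `v` is the trace `w(0, ·)` of `w ∈ H¹(ℝ × 𝕋_T)`, characterised by Green's formula
`∫_{x > 0} (∂ₓw ψ + w ∂ₓψ) = - ∫ v ψ(0, ·)`. -/
def IsTraceAtZero (T : ℝ) (w wx : ℝ × ℝ → ℝ) (v : ℝ → ℝ) : Prop :=
  MemLp v 2 (volume.restrict (Ioc 0 T)) ∧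
  ∀ ψ, IsTestFunction T ψ →
    ∫ p in Ioi (0 : ℝ) ×ˢ Ioc 0 T, (wx p * ψ p + w p * dx ψ p) =
      -∫ t in Ioc 0 T, v t * ψ (0, t)

/-- `z` is the weak derivative of `v` on the torus `𝕋_T`. -/
def IsWeakDerivTorus (T : ℝ) (v z : ℝ → ℝ) : Prop :=
  ∀ η : ℝ → ℝ, ContDiff ℝ (⊤ : ℕ∞) η → (∀ t, η (t + T) = η t) →
    ∫ t in Ioc 0 T, v t * deriv η t = -∫ t in Ioc 0 T, z t * η t

/-- `w` is a `T`-periodic weak solution of `g(x) w_tt - w_xx + γ δ₀(x) (w_t³)_t = 0`: it is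
`T`-periodic in time, lies in `H¹(ℝ × 𝕋_T)`, the time derivative `z = ∂ₜw(0, ·)` of its trace at
`x = 0` lies in `L³(𝕋_T)`, and the weak form of the equation holds. -/
def IsWeakSolution (g : ℝ → ℝ) (γ T : ℝ) (w : ℝ × ℝ → ℝ) : Prop :=
  (∀ x t, w (x, t + T) = w (x, t)) ∧
  ∃ (wx wt : ℝ × ℝ → ℝ) (v z : ℝ → ℝ),
    HasH1Derivs T w wx wt ∧
    IsTraceAtZero T w wx v ∧
    IsWeakDerivTorus T v z ∧
    MemLp z 3 (volume.restrict (Ioc 0 T)) ∧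
    ∀ ψ, IsTestFunction T ψ →
      (∫ p in strip T, (-(g p.1) * wt p * dt ψ p + wx p * dx ψ p)) -
        γ * ∫ t in Ioc 0 T, z t ^ 3 * dt ψ (0, t) = 0

end

end Breather

/-!
Writing `w(x, t) = ∑ αₙ Φ_{|n|}(|x|) eₙ(t)` over the odd integers `n`, with `eₙ` the real
trigonometric function `cos (nωt) + sin (nωt)`, turns the equation away from `x = 0` into the
equations for the `Φₖ`, and what remains is the jump condition at `x = 0`. With
`z = ∂ₜ w(0, ·) = ∑ zₙ eₙ` this condition is the Euler-Lagrange equation of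
`J(z) = ∫ z⁴ / 4 + ∑ cₙ zₙ²`, where `cₙ = Φ_{|n|}'(0) / (γ n² ω²)`, on the space of
`T/2`-antiperiodic functions in `L⁴` of the circle.

The uniform decay of the `Φₖ` gives `|Φₖ'(x)| ≤ A k e^{-ρx}` by Landau's inequality
(`IsDecayingSolution.exists_isProfile`). So `cₙ = O(1/n)`, the quadratic part of `J` is
compact with respect to `L²`, and `J` attains its minimum. Weak compactness is not needed: along a
minimizing sequence whose coefficients converge, Clarkson's inequality in `L⁴` yields a Cauchy
sequence (`exists_forall_quartic_add_quadratic_le`, `exists_critical_point`). The sign condition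
makes some `cₙ` negative, so `J` takes negative values and the minimizer is not zero. Since the cube
of an antiperiodic function is antiperiodic, the Euler-Lagrange equation holds in all directions
(`integral_cube_mul_eq`).

The coefficients `αₙ = z₋ₙ / (nω)` satisfy `∑ n² αₙ² < ∞`. By Cauchy-Schwarz `∑ |αₙ| < ∞`, whence
the pointwise exponential decay of `w`; and the series for `∂ₓ w` and `∂ₜ w` are orthogonal in `L²`
of the strip with square summable norms, so the weak identities of the single modes
(`IsLineProfile.weak_form`) may be summed (`exists_wave`).

The functions `Φₖ` exist because `0` is in the resolvent set of the Dirichlet operators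
(`exists_isDecayingSolution`); neither their uniqueness nor the essential spectrum plays a role.
-/

namespace Breather

open AddCircle

/-! ### Minimizing a quartic plus a compact quadratic form -/

/-- **Direct method without weak compactness.** A sequence minimizing `‖x‖⁴ / 4 + Q x` is bounded;
along a subsequence with `Q (x_m - x_n) → 0`, the Clarkson inequality for `‖·‖⁴` and the
parallelogram identity for `Q` make it a Cauchy sequence. -/
theorem exists_forall_quartic_add_quadratic_le {E : Type*} [NormedAddCommGroup E]
    [NormedSpace ℝ E] [CompleteSpace E] (Q : E → ℝ)
    (hconv : ∀ x y : E, ‖(2⁻¹ : ℝ) • (x + y)‖ ^ 4 + ‖(2⁻¹ : ℝ) • (x - y)‖ ^ 4 ≤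
      (‖x‖ ^ 4 + ‖y‖ ^ 4) / 2)
    (hpar : ∀ x y : E, Q ((2⁻¹ : ℝ) • (x + y)) + Q ((2⁻¹ : ℝ) • (x - y)) = (Q x + Q y) / 2)
    (hcont : Continuous Q) (C : ℝ) (hbound : ∀ x, |Q x| ≤ C * ‖x‖ ^ 2)
    (hcomp : ∀ (u : ℕ → E) (R : ℝ), (∀ n, ‖u n‖ ≤ R) → ∃ φ : ℕ → ℕ, StrictMono φ ∧
      ∀ ε > 0, ∃ N, ∀ m ≥ N, ∀ n ≥ N, |Q ((2⁻¹ : ℝ) • (u (φ m) - u (φ n)))| < ε) :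
    ∃ z, ∀ y, ‖z‖ ^ 4 / 4 + Q z ≤ ‖y‖ ^ 4 / 4 + Q y := by
  set J : E → ℝ := fun x => ‖x‖ ^ 4 / 4 + Q x with hJ
  -- completing the square bounds `J` from below and, where `J` is bounded above, bounds `‖x‖`
  have hlow : ∀ x, (‖x‖ ^ 2 / 2 - C) ^ 2 - C ^ 2 ≤ J x := fun x => by
    have := neg_le_of_abs_le (hbound x)
    simp only [hJ]
    nlinarith
  have hbdd : BddBelow (range J) := ⟨-C ^ 2, by
    rintro _ ⟨x, rfl⟩
    nlinarith [hlow x, sq_nonneg (‖x‖ ^ 2 / 2 - C)]⟩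
  set m := sInf (range J) with hm
  have hmle : ∀ x, m ≤ J x := fun x => csInf_le hbdd ⟨x, rfl⟩
  have hex : ∀ n : ℕ, ∃ x, J x < m + 1 / ((n : ℝ) + 1) := fun n => by
    obtain ⟨_, ⟨x, rfl⟩, hx⟩ := exists_lt_of_csInf_lt (range_nonempty J)
      (show sInf (range J) < m + 1 / ((n : ℝ) + 1) by
        have : (0 : ℝ) < 1 / ((n : ℝ) + 1) := by positivity
        linarith)
    exact ⟨x, hx⟩
  choose u hu using hex
  have hub : ∀ n, ‖u n‖ ≤ 2 * (C + (m + 1 + C ^ 2) + 1) + 1 := fun n => by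
    have h1 : (1 : ℝ) / ((n : ℝ) + 1) ≤ 1 := by
      rw [div_le_one (by positivity)]
      linarith [(Nat.cast_nonneg n : (0 : ℝ) ≤ n)]
    have h2 := hlow (u n)
    have h3 := hu n
    have h4 : ‖u n‖ ^ 2 / 2 - C ≤ (m + 1 + C ^ 2) + 1 := by
      nlinarith [sq_nonneg (‖u n‖ ^ 2 / 2 - C - 1)]
    nlinarith [sq_nonneg (‖u n‖ - 1)]
  obtain ⟨φ, hφ, hQ⟩ := hcomp u _ hub
  have hsub : ∀ n, J (u (φ n)) < m + 1 / ((n : ℝ) + 1) := fun n => by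
    refine (hu (φ n)).trans_le ?_
    have : (n : ℝ) ≤ φ n := by exact_mod_cast hφ.id_le n
    gcongr
  have hcauchy : CauchySeq fun n => u (φ n) := by
    rw [Metric.cauchySeq_iff]
    intro ε hε
    obtain ⟨N, hN⟩ := hQ (ε ^ 4 / 128) (by positivity)
    obtain ⟨K, hK⟩ := exists_nat_one_div_lt (show 0 < ε ^ 4 / 128 by positivity)
    refine ⟨max N K, fun i hi j hj => ?_⟩
    have bd : ∀ l ≥ max N K, J (u (φ l)) < m + ε ^ 4 / 128 := fun l hl => by
      have : (1 : ℝ) / ((l : ℝ) + 1) ≤ 1 / ((K : ℝ) + 1) := by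
        have : (K : ℝ) ≤ l := by exact_mod_cast (le_max_right N K).trans hl
        gcongr
      linarith [hsub l]
    have h1 := hconv (u (φ i)) (u (φ j))
    have h2 := hpar (u (φ i)) (u (φ j))
    have h3 := hmle ((2⁻¹ : ℝ) • (u (φ i) + u (φ j)))
    have h4 := neg_lt_of_abs_lt
      (hN i ((le_max_left _ _).trans hi) j ((le_max_left _ _).trans hj))
    have h5 := bd i hi
    have h6 := bd j hj
    simp only [hJ] at h3 h5 h6
    rw [dist_eq_norm]
    have h7 : ‖(2⁻¹ : ℝ) • (u (φ i) - u (φ j))‖ ^ 4 = ‖u (φ i) - u (φ j)‖ ^ 4 / 16 := by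
      rw [norm_smul, mul_pow, Real.norm_of_nonneg (by norm_num)]
      ring
    rw [h7] at h1
    have h8 : ‖u (φ i) - u (φ j)‖ ^ 4 < ε ^ 4 := by linarith
    exact lt_of_pow_lt_pow_left₀ 4 hε.le h8
  obtain ⟨z, hz⟩ := cauchySeq_tendsto_of_complete hcauchy
  refine ⟨z, fun y => ?_⟩
  have hJc : Continuous J := by fun_prop
  have hlim : Tendsto (fun n => J (u (φ n))) atTop (nhds (J z)) := (hJc.tendsto z).comp hz
  have hlim' : Tendsto (fun n : ℕ => m + 1 / ((n : ℝ) + 1)) atTop (nhds (m + 0)) :=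
    tendsto_const_nhds.add tendsto_one_div_add_atTop_nhds_zero_nat
  have := le_of_tendsto_of_tendsto' hlim hlim' fun n => (hsub n).le
  exact (this.trans (by rw [add_zero])).trans (hmle y)

section DiagonalForm

variable {ι H : Type*} [NormedAddCommGroup H] [InnerProductSpace ℝ H]

/-- The bilinear form which is diagonal in the Hilbert basis `b`, with diagonal entries `c`. -/
noncomputable def diagonalForm (b : HilbertBasis ι ℝ H) (c : ι → ℝ) (x y : H) : ℝ :=
  ∑' n, c n * (inner ℝ (b n) x * inner ℝ (b n) y)

variable (b : HilbertBasis ι ℝ H) {c : ι → ℝ} {K : ℝ}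

theorem hasSum_inner_sq (x : H) : HasSum (fun n => inner ℝ (b n) x ^ 2) (‖x‖ ^ 2) := by
  have := b.hasSum_inner_mul_inner x x
  rw [real_inner_self_eq_norm_sq] at this
  refine this.congr_fun fun n => ?_
  rw [real_inner_comm x, sq]

theorem summable_inner_mul_inner' (x y : H) :
    Summable fun n => inner ℝ (b n) x * inner ℝ (b n) y := by
  refine (b.summable_inner_mul_inner x y).congr fun n => ?_
  rw [real_inner_comm x]

theorem summable_diagonalForm (hc : ∀ n, |c n| ≤ K) (x y : H) :
    Summable fun n => c n * (inner ℝ (b n) x * inner ℝ (b n) y) := by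
  refine Summable.of_norm_bounded ((summable_inner_mul_inner' b x y).norm.mul_left K) fun n => ?_
  rw [norm_mul]
  exact mul_le_mul_of_nonneg_right (hc n) (norm_nonneg _)

theorem diagonalForm_add_left (hc : ∀ n, |c n| ≤ K) (x y z : H) :
    diagonalForm b c (x + y) z = diagonalForm b c x z + diagonalForm b c y z := by
  rw [diagonalForm, diagonalForm, diagonalForm,
    ← (summable_diagonalForm b hc x z).tsum_add (summable_diagonalForm b hc y z)]
  refine tsum_congr fun n => ?_
  rw [inner_add_right]
  ring

theorem diagonalForm_smul_left (t : ℝ) (x z : H) :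
    diagonalForm b c (t • x) z = t * diagonalForm b c x z := by
  rw [diagonalForm, diagonalForm, ← tsum_mul_left]
  refine tsum_congr fun n => ?_
  rw [real_inner_smul_right]
  ring

theorem diagonalForm_comm (x y : H) : diagonalForm b c x y = diagonalForm b c y x :=
  tsum_congr fun n => by ring

theorem diagonalForm_add_smul_self (hc : ∀ n, |c n| ≤ K) (x y : H) (t : ℝ) :
    diagonalForm b c (x + t • y) (x + t • y) =
      diagonalForm b c x x + 2 * t * diagonalForm b c x y + t ^ 2 * diagonalForm b c y y := by
  rw [diagonalForm_add_left b hc, diagonalForm_smul_left, diagonalForm_comm b x,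
    diagonalForm_comm b y, diagonalForm_add_left b hc, diagonalForm_add_left b hc,
    diagonalForm_smul_left, diagonalForm_smul_left, diagonalForm_comm b y x]
  ring

theorem abs_diagonalForm_self_le (hc : ∀ n, |c n| ≤ K) (x : H) :
    |diagonalForm b c x x| ≤ K * ‖x‖ ^ 2 := by
  have h := (hasSum_inner_sq b x).mul_left K
  rw [diagonalForm, ← h.tsum_eq, ← Real.norm_eq_abs]
  refine tsum_of_norm_bounded h.summable.hasSum fun n => ?_
  rw [norm_mul, ← sq, Real.norm_of_nonneg (sq_nonneg (inner ℝ (b n) x))]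
  exact mul_le_mul_of_nonneg_right (hc n) (sq_nonneg _)

/-- The polarized bound, obtained from the quadratic one by scaling. -/
theorem abs_diagonalForm_le (hc : ∀ n, |c n| ≤ K) (x y : H) :
    |diagonalForm b c x y| ≤ K * ‖x‖ * ‖y‖ := by
  have h1 : ∀ t : ℝ, diagonalForm b c (x + t • y) (x + t • y) - diagonalForm b c (x - t • y)
      (x - t • y) = 4 * t * diagonalForm b c x y := fun t => by
    have h2 := diagonalForm_add_smul_self b hc x y t
    have h3 := diagonalForm_add_smul_self b hc x y (-t)
    rw [neg_smul, ← sub_eq_add_neg] at h3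
    rw [h2, h3]
    ring
  have h4 : ∀ t : ℝ, |4 * t * diagonalForm b c x y| ≤ 2 * K * (‖x‖ ^ 2 + t ^ 2 * ‖y‖ ^ 2) := by
    intro t
    rw [← h1]
    have h5 := abs_diagonalForm_self_le b hc (x + t • y)
    have h6 := abs_diagonalForm_self_le b hc (x - t • y)
    have h7 := parallelogram_law_with_norm ℝ x (t • y)
    have h8 : ‖t • y‖ ^ 2 = t ^ 2 * ‖y‖ ^ 2 := by
      rw [norm_smul, Real.norm_eq_abs, mul_pow, sq_abs]
    rw [h8] at h7
    calc _ ≤ _ := abs_sub _ _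
      _ ≤ K * ‖x + t • y‖ ^ 2 + K * ‖x - t • y‖ ^ 2 := add_le_add h5 h6
      _ = K * (‖x + t • y‖ ^ 2 + ‖x - t • y‖ ^ 2) := by ring
      _ = _ := by rw [h7]; ring
  rcases eq_or_ne y 0 with rfl | hy
  · have := h4 1
    have h9 : diagonalForm b c x 0 = 0 := by simp [diagonalForm]
    simp [h9]
  rcases eq_or_ne x 0 with rfl | hx
  · have h9 : diagonalForm b c 0 y = 0 := by simp [diagonalForm]
    simp [h9]
  -- the two terms on the right of `h4` balance for `t = ‖x‖ / ‖y‖`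
  have hx' := norm_pos_iff.2 hx
  have hy' := norm_pos_iff.2 hy
  have h := h4 (‖x‖ / ‖y‖)
  rw [abs_mul, abs_of_pos (by positivity : 0 < 4 * (‖x‖ / ‖y‖))] at h
  have e : 2 * K * (‖x‖ ^ 2 + (‖x‖ / ‖y‖) ^ 2 * ‖y‖ ^ 2) =
      4 * (‖x‖ / ‖y‖) * (K * ‖x‖ * ‖y‖) := by
    field_simp
    ring
  rw [e] at h
  exact le_of_mul_le_mul_left h (by positivity)

theorem continuous_diagonalForm_self (hc : ∀ n, |c n| ≤ K) :
    Continuous fun x : H => diagonalForm b c x x := by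
  rw [continuous_iff_continuousAt]
  intro x
  have hK : ∀ y, diagonalForm b c y y - diagonalForm b c x x =
      2 * diagonalForm b c x (y - x) + diagonalForm b c (y - x) (y - x) := fun y => by
    have := diagonalForm_add_smul_self b hc x (y - x) 1
    simp only [one_smul, add_sub_cancel] at this
    rw [this]
    ring
  have hlim : Tendsto (fun y => 2 * (K * ‖x‖ * ‖y - x‖) + K * ‖y - x‖ ^ 2) (nhds x) (nhds 0) := by
    have : Continuous fun y : H => 2 * (K * ‖x‖ * ‖y - x‖) + K * ‖y - x‖ ^ 2 := by fun_prop
    simpa using this.tendsto x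
  rw [ContinuousAt, tendsto_iff_norm_sub_tendsto_zero]
  refine squeeze_zero (fun _ => norm_nonneg _) (fun y => ?_) hlim
  rw [hK, Real.norm_eq_abs]
  refine (abs_add_le _ _).trans (add_le_add ?_ (abs_diagonalForm_self_le b hc _))
  rw [abs_mul, abs_two]
  exact mul_le_mul_of_nonneg_left (abs_diagonalForm_le b hc _ _) (by norm_num)

/-- Compactness of a diagonal quadratic form whose entries tend to zero. -/
theorem exists_subseq_diagonalForm_sub_lt [Countable ι]
    (hc0 : Tendsto c cofinite (nhds 0)) (u : ℕ → H) (R : ℝ) (hR : ∀ n, ‖u n‖ ≤ R) :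
    ∃ φ : ℕ → ℕ, StrictMono φ ∧ ∀ ε > 0, ∃ N, ∀ m ≥ N, ∀ n ≥ N,
      |diagonalForm b c (u (φ m) - u (φ n)) (u (φ m) - u (φ n))| < ε := by
  have hcpt : IsCompact (univ.pi fun _ : ι => Icc (-R) R) := isCompact_univ_pi fun _ => isCompact_Icc
  have hmem : ∀ m, (fun n => inner ℝ (b n) (u m)) ∈ univ.pi fun _ : ι => Icc (-R) R := by
    intro m n _
    have h := (abs_real_inner_le_norm (b n) (u m)).trans
      (mul_le_mul_of_nonneg_left (hR m) (norm_nonneg _))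
    rw [b.orthonormal.1 n, one_mul] at h
    exact abs_le.1 h
  -- Tychonoff: a subsequence along which every coefficient converges
  obtain ⟨a, -, φ, hφ, hlim⟩ := hcpt.tendsto_subseq hmem
  rw [tendsto_pi_nhds] at hlim
  refine ⟨φ, hφ, fun ε hε => ?_⟩
  have hR0 : 0 ≤ R := (norm_nonneg _).trans (hR 0)
  -- `δ` controls the tail, where `‖u m - u n‖² ≤ 4 R²`
  set δ := ε / (2 * (4 * R ^ 2 + 1)) with hδ
  have hδ0 : 0 < δ := by positivity
  have hfin : {n | ¬ |c n| < δ}.Finite := by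
    have := hc0.eventually (Metric.ball_mem_nhds (0 : ℝ) hδ0)
    rw [Filter.eventually_cofinite] at this
    simpa using this
  set s := hfin.toFinset with hs
  have hcs : ∀ n ∉ s, |c n| < δ := fun n hn => by
    by_contra h
    exact hn (hfin.mem_toFinset.2 h)
  have hsum0 : Tendsto (fun p : ℕ × ℕ => ∑ n ∈ s, |c n| *
      (inner ℝ (b n) (u (φ p.1)) - inner ℝ (b n) (u (φ p.2))) ^ 2) (atTop ×ˢ atTop) (nhds 0) := by
    have : Tendsto (fun p : ℕ × ℕ => ∑ n ∈ s, |c n| *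
      (inner ℝ (b n) (u (φ p.1)) - inner ℝ (b n) (u (φ p.2))) ^ 2) (atTop ×ˢ atTop)
      (nhds (∑ n ∈ s, |c n| * (a n - a n) ^ 2)) :=
      tendsto_finsetSum _ fun n _ => ((((hlim n).comp tendsto_fst).sub
        ((hlim n).comp tendsto_snd)).pow 2).const_mul _
    simpa using this
  rw [prod_atTop_atTop_eq] at hsum0
  obtain ⟨⟨N₁, N₂⟩, hN⟩ := eventually_atTop.1
    (hsum0.eventually (gt_mem_nhds (show 0 < ε / 2 by positivity)))
  refine ⟨max N₁ N₂, fun i hi j hj => ?_⟩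
  have h1 := hN (i, j) ⟨(le_max_left _ _).trans hi, (le_max_right _ _).trans hj⟩
  simp only at h1
  set x := u (φ i) - u (φ j) with hx
  have hxn : ‖x‖ ≤ 2 * R := (norm_sub_le _ _).trans (by linarith [hR (φ i), hR (φ j)])
  have hS := ((hasSum_inner_sq b x).mul_left δ)
  have hle : ∀ n, ‖c n * (inner ℝ (b n) x * inner ℝ (b n) x)‖ ≤
      (δ * inner ℝ (b n) x ^ 2 + (s : Set ι).indicator (fun n => |c n| * inner ℝ (b n) x ^ 2) n) := by
    intro n
    rw [norm_mul, ← sq, Real.norm_of_nonneg (sq_nonneg (inner ℝ (b n) x)), Real.norm_eq_abs]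
    by_cases hn : n ∈ s
    · rw [indicator_of_mem (by exact_mod_cast hn)]
      have : 0 ≤ δ * inner ℝ (b n) x ^ 2 := by positivity
      linarith
    · rw [indicator_of_notMem (by exact_mod_cast hn), add_zero]
      exact mul_le_mul_of_nonneg_right (hcs n hn).le (sq_nonneg _)
  have hT : HasSum ((s : Set ι).indicator (fun n => |c n| * inner ℝ (b n) x ^ 2))
      (∑ n ∈ s, |c n| * inner ℝ (b n) x ^ 2) := by
    rw [← Finset.sum_congr rfl fun n hn => indicator_of_mem (s := (s : Set ι))
      (Finset.mem_coe.2 hn) fun n => |c n| * inner ℝ (b n) x ^ 2]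
    exact hasSum_sum_of_ne_finset_zero fun n hn => indicator_of_notMem (by exact_mod_cast hn) _
  have h2 := tsum_of_norm_bounded (hS.add hT) hle
  rw [← diagonalForm, Real.norm_eq_abs] at h2
  have h3 : ∑ n ∈ s, |c n| * inner ℝ (b n) x ^ 2 < ε / 2 := by
    simpa only [hx, inner_sub_right] using h1
  have h4 : δ * ‖x‖ ^ 2 ≤ ε / 2 := by
    have h5 : ‖x‖ ^ 2 ≤ 4 * R ^ 2 + 1 := by nlinarith [norm_nonneg x]
    calc δ * ‖x‖ ^ 2 ≤ δ * (4 * R ^ 2 + 1) := by gcongr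
      _ = ε / 2 := by
        rw [hδ]
        field_simp
  linarith

end DiagonalForm

/-! ### A real trigonometric basis on the circle -/

section Cas

variable {T : ℝ}

/-- The function `t ↦ cos (2πnt/T) + sin (2πnt/T)` on the circle. For `n` running through `ℤ` these
functions form a real orthonormal basis of `L²`. -/
noncomputable def cas (n : ℤ) : C(AddCircle T, ℝ) where
  toFun x := (fourier n x).re + (fourier n x).im
  continuous_toFun := by fun_prop

theorem cas_apply (n : ℤ) (x : AddCircle T) : cas n x = (fourier n x).re + (fourier n x).im := rfl

variable (T) in
/-- Half a period, as a point of the circle. -/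
noncomputable def halfPeriod : AddCircle T := ((T / 2 : ℝ) : AddCircle T)

theorem halfPeriod_add_halfPeriod : halfPeriod T + halfPeriod T = 0 := by
  rw [halfPeriod, ← AddCircle.coe_add, add_halves, AddCircle.coe_period]

theorem fourier_add_point (n : ℤ) (x y : AddCircle T) :
    fourier n (x + y) = fourier n x * fourier n y := by
  simp only [fourier_apply, smul_add, toCircle_add, Circle.coe_mul]

theorem cas_mul_cas (n m : ℤ) (x : AddCircle T) :
    cas n x * cas m x = (fourier (n - m) x).re + (fourier (n + m) x).im := by
  rw [sub_eq_add_neg, fourier_add, fourier_add, fourier_neg, cas_apply, cas_apply, Complex.mul_re,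
    Complex.mul_im, Complex.conj_re, Complex.conj_im]
  ring

variable [hT : Fact (0 < T)]

theorem integral_fourier (n : ℤ) :
    ∫ x : AddCircle T, fourier n x ∂haarAddCircle = if n = 0 then 1 else 0 := by
  have h := congrFun (fourierCoeff_fourier (T := T) n) 0
  rw [fourierCoeff] at h
  simp only [neg_zero, fourier_zero, one_smul] at h
  rw [h, Pi.single_apply]
  simp [eq_comm]

theorem integrable_continuousMap (f : C(AddCircle T, ℂ)) : Integrable f haarAddCircle :=
  f.continuous.integrable_of_hasCompactSupport (HasCompactSupport.of_compactSpace _)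

theorem integral_cas_mul_cas (n m : ℤ) :
    ∫ x : AddCircle T, cas n x * cas m x ∂haarAddCircle = if n = m then 1 else 0 := by
  simp_rw [cas_mul_cas]
  have h1 := integrable_continuousMap (fourier (T := T) (n - m))
  have h2 := integrable_continuousMap (fourier (T := T) (n + m))
  have e0 := integral_add h1.re h2.im
  have e1 := integral_re h1
  have e2 := integral_im h2
  simp only [RCLike.re_to_complex, RCLike.im_to_complex] at e0 e1 e2
  rw [e0, e1, e2, integral_fourier, integral_fourier]
  split_ifs <;> simp_all [sub_eq_zero]

theorem memLp_continuousMap (f : C(AddCircle T, ℝ)) (p : ℝ≥0∞) : MemLp f p haarAddCircle :=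
  f.continuous.memLp_of_hasCompactSupport (HasCompactSupport.of_compactSpace _)

theorem inner_eq_integral {Ω : Type*} [MeasurableSpace Ω] {μ : Measure Ω} (f g : Lp ℝ 2 μ) :
    inner ℝ f g = ∫ x, f x * g x ∂μ := by
  rw [L2.inner_def]
  exact integral_congr_ae (Eventually.of_forall fun x => mul_comm _ _)

theorem inner_toLp_left {Ω : Type*} [MeasurableSpace Ω] {μ : Measure Ω} {f : Ω → ℝ}
    (hf : MemLp f 2 μ) (g : Lp ℝ 2 μ) : inner ℝ (hf.toLp f) g = ∫ x, f x * g x ∂μ := by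
  rw [inner_eq_integral]
  refine integral_congr_ae ?_
  filter_upwards [hf.coeFn_toLp] with x hx
  rw [hx]

theorem inner_toLp_toLp {Ω : Type*} [MeasurableSpace Ω] {μ : Measure Ω} {f g : Ω → ℝ}
    (hf : MemLp f 2 μ) (hg : MemLp g 2 μ) :
    inner ℝ (hf.toLp f) (hg.toLp g) = ∫ x, f x * g x ∂μ := by
  rw [inner_toLp_left]
  refine integral_congr_ae ?_
  filter_upwards [hg.coeFn_toLp] with x hx
  rw [hx]

theorem orthonormal_cas : Orthonormal ℝ fun n : ℤ =>
    (memLp_continuousMap (T := T) (cas n) 2).toLp (cas n) := by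
  classical
  rw [orthonormal_iff_ite]
  intro n m
  rw [inner_toLp_toLp, integral_cas_mul_cas]

/-- Completeness follows from that of the complex exponentials, since the real and imaginary part
of `fourier n` are `(cas n + cas (-n)) / 2` and `(cas n - cas (-n)) / 2`. -/
theorem eq_zero_of_integral_cas_mul (f : Lp ℝ 2 (haarAddCircle (T := T)))
    (hf : ∀ n : ℤ, ∫ x, cas n x * f x ∂haarAddCircle = 0) : f = 0 := by
  have hint : ∀ g : C(AddCircle T, ℝ), Integrable (fun x => g x * f x) haarAddCircle := fun g =>
    (memLp_continuousMap g 2).integrable_mul (Lp.memLp f)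
  have hre : ∀ n : ℤ, ∫ x, (fourier n x).re * f x ∂haarAddCircle = 0 := fun n => by
    have e : ∀ x, (fourier n x).re * f x = 2⁻¹ * (cas n x * f x) + 2⁻¹ * (cas (-n) x * f x) :=
      fun x => by
        rw [cas_apply, cas_apply, fourier_neg, Complex.conj_re, Complex.conj_im]
        ring
    simp_rw [e]
    rw [integral_add ((hint _).const_mul _) ((hint _).const_mul _), integral_const_mul,
      integral_const_mul, hf, hf]
    simp
  have him : ∀ n : ℤ, ∫ x, (fourier n x).im * f x ∂haarAddCircle = 0 := fun n => by
    have e : ∀ x, (fourier n x).im * f x = 2⁻¹ * (cas n x * f x) - 2⁻¹ * (cas (-n) x * f x) :=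
      fun x => by
        rw [cas_apply, cas_apply, fourier_neg, Complex.conj_re, Complex.conj_im]
        ring
    simp_rw [e]
    rw [integral_sub ((hint _).const_mul _) ((hint _).const_mul _), integral_const_mul,
      integral_const_mul, hf, hf]
    simp
  have hF : MemLp (fun x => ((f x : ℝ) : ℂ)) 2 (haarAddCircle (T := T)) := (Lp.memLp f).ofReal
  have hcoef : ∀ n : ℤ, fourierCoeff (hF.toLp _) n = 0 := fun n => by
    rw [fourierCoeff_congr_ae hF.coeFn_toLp, fourierCoeff]
    have hI : Integrable (fun x => fourier (-n) x • ((f x : ℝ) : ℂ)) (haarAddCircle (T := T)) :=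
      ((Lp.memLp f).integrable (by norm_num)).ofReal.fourier_smul (-n)
    have e1 := integral_re hI
    have e2 := integral_im hI
    simp only [RCLike.re_to_complex, RCLike.im_to_complex, smul_eq_mul, Complex.re_mul_ofReal,
      Complex.im_mul_ofReal] at e1 e2
    rw [hre] at e1
    rw [him] at e2
    exact Complex.ext e1.symm e2.symm
  have h0 : hF.toLp _ = 0 := by
    refine (fourierBasis (T := T)).repr.injective ?_
    ext n
    rw [fourierBasis_repr, hcoef]
    simp
  rw [Lp.eq_zero_iff_ae_eq_zero] at h0 ⊢
  filter_upwards [h0, hF.coeFn_toLp] with x h1 h2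
  rw [h1] at h2
  exact Complex.ofReal_eq_zero.1 h2.symm

/-- The real Hilbert basis of `L²` of the circle consisting of the functions `cas n`. -/
noncomputable def casBasis : HilbertBasis ℤ ℝ (Lp ℝ 2 (haarAddCircle (T := T))) :=
  HilbertBasis.mkOfOrthogonalEqBot orthonormal_cas <| by
    rw [Submodule.eq_bot_iff]
    intro f hf
    refine eq_zero_of_integral_cas_mul f fun n => ?_
    rw [← inner_toLp_left (memLp_continuousMap (cas n) 2)]
    exact (Submodule.mem_orthogonal _ _).1 hf _ (Submodule.subset_span ⟨n, rfl⟩)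

theorem casBasis_apply (n : ℤ) :
    casBasis (T := T) n = (memLp_continuousMap (cas n) 2).toLp (cas n) := by
  rw [casBasis, HilbertBasis.coe_mkOfOrthogonalEqBot]

/-- The coefficient of `z` with respect to `cas n`. -/
noncomputable def casCoeff (z : AddCircle T → ℝ) (n : ℤ) : ℝ :=
  ∫ x, cas n x * z x ∂haarAddCircle

theorem inner_casBasis {z : AddCircle T → ℝ} (hz : MemLp z 2 haarAddCircle) (n : ℤ) :
    inner ℝ (casBasis n) (hz.toLp z) = casCoeff z n := by
  rw [casBasis_apply, inner_toLp_toLp, casCoeff]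

theorem hasSum_casCoeff_mul {z h : AddCircle T → ℝ} (hz : MemLp z 2 haarAddCircle)
    (hh : MemLp h 2 haarAddCircle) :
    HasSum (fun n => casCoeff z n * casCoeff h n) (∫ x, z x * h x ∂haarAddCircle) := by
  have := casBasis.hasSum_inner_mul_inner (hz.toLp z) (hh.toLp h)
  rw [inner_toLp_toLp] at this
  refine this.congr_fun fun n => ?_
  rw [inner_casBasis, real_inner_comm, inner_casBasis]

theorem fourier_halfPeriod (n : ℤ) : fourier n (halfPeriod T) = (-1 : ℂ) ^ n := by
  rw [halfPeriod, fourier_coe_apply, ← Complex.exp_pi_mul_I, ← Complex.exp_int_mul]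
  congr 1
  have : (T : ℂ) ≠ 0 := by exact_mod_cast hT.out.ne'
  push_cast
  field_simp

theorem cas_add_halfPeriod_of_odd {n : ℤ} (hn : Odd n) (x : AddCircle T) :
    cas n (x + halfPeriod T) = -cas n x := by
  rw [cas_apply, fourier_add_point, fourier_halfPeriod, hn.neg_one_zpow, cas_apply]
  simp only [mul_neg, mul_one, Complex.neg_re, Complex.neg_im]
  ring

theorem cas_add_halfPeriod_of_even {n : ℤ} (hn : Even n) (x : AddCircle T) :
    cas n (x + halfPeriod T) = cas n x := by
  rw [cas_apply, fourier_add_point, fourier_halfPeriod, hn.neg_one_zpow, mul_one, cas_apply]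

theorem integral_comp_add_halfPeriod (f : AddCircle T → ℝ) :
    ∫ x, f (x + halfPeriod T) ∂haarAddCircle = ∫ x, f x ∂haarAddCircle :=
  integral_add_right_eq_self f _

theorem casCoeff_comp_add_halfPeriod_of_odd {n : ℤ} (hn : Odd n) (z : AddCircle T → ℝ) :
    casCoeff (fun x => z (x + halfPeriod T)) n = -casCoeff z n := by
  rw [casCoeff, casCoeff, ← integral_comp_add_halfPeriod, ← integral_neg]
  refine integral_congr_ae (Eventually.of_forall fun x => ?_)
  simp only
  rw [add_assoc, halfPeriod_add_halfPeriod, add_zero, cas_add_halfPeriod_of_odd hn]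
  ring

theorem casCoeff_eq_zero_of_even {n : ℤ} (hn : Even n) {z : AddCircle T → ℝ}
    (hz : ∀ᵐ x ∂haarAddCircle, z (x + halfPeriod T) = -z x) : casCoeff z n = 0 := by
  have h : casCoeff z n = -casCoeff z n := by
    conv_lhs => rw [casCoeff, ← integral_comp_add_halfPeriod]
    rw [casCoeff, ← integral_neg]
    refine integral_congr_ae ?_
    filter_upwards [hz] with x hx
    rw [hx, cas_add_halfPeriod_of_even hn]
    ring
  linarith

end Cas

/-! ### The reduced functional on `L⁴` of the circle -/

instance fact_one_le_four : Fact ((1 : ℝ≥0∞) ≤ 4) := ⟨by norm_num⟩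

section Quartic

variable {Ω : Type*} [MeasurableSpace Ω] {μ : Measure Ω}

theorem integrable_pow_four {f : Ω → ℝ} (hf : MemLp f 4 μ) : Integrable (fun x => f x ^ 4) μ := by
  have h := hf.integrable_norm_pow (p := 4) (by norm_num)
  refine h.congr (Eventually.of_forall fun x => ?_)
  simp only [Real.norm_eq_abs]
  exact (show Even 4 by decide).pow_abs _

theorem norm_pow_four_eq_integral (z : Lp ℝ 4 μ) : ‖z‖ ^ 4 = ∫ x, z x ^ 4 ∂μ := by
  have h0 : 0 ≤ ∫ x, z x ^ 4 ∂μ := integral_nonneg fun x => by positivity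
  rw [Lp.norm_def, (Lp.memLp z).eLpNorm_eq_integral_rpow_norm (by norm_num) (by norm_num)]
  have e : ∫ x, ‖z x‖ ^ (4 : ℝ≥0∞).toReal ∂μ = ∫ x, z x ^ 4 ∂μ := by
    refine integral_congr_ae (Eventually.of_forall fun x => ?_)
    simp only [ENNReal.toReal_ofNat, Real.norm_eq_abs]
    rw [show (4 : ℝ) = ((4 : ℕ) : ℝ) by norm_num, Real.rpow_natCast]
    exact (show Even 4 by decide).pow_abs _
  rw [e, ENNReal.toReal_ofReal (by positivity), ← Real.rpow_natCast, ← Real.rpow_mul h0]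
  simp

/-- The Clarkson inequality in `L⁴`. -/
theorem clarkson_L4 (x y : Lp ℝ 4 μ) :
    ‖(2⁻¹ : ℝ) • (x + y)‖ ^ 4 + ‖(2⁻¹ : ℝ) • (x - y)‖ ^ 4 ≤ (‖x‖ ^ 4 + ‖y‖ ^ 4) / 2 := by
  rw [norm_pow_four_eq_integral, norm_pow_four_eq_integral, norm_pow_four_eq_integral x,
    norm_pow_four_eq_integral y, ← integral_add (integrable_pow_four (Lp.memLp _))
    (integrable_pow_four (Lp.memLp _)), ← integral_add (integrable_pow_four (Lp.memLp _))
    (integrable_pow_four (Lp.memLp _)), ← integral_div]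
  refine integral_mono_ae ((integrable_pow_four (Lp.memLp _)).add
    (integrable_pow_four (Lp.memLp _))) (((integrable_pow_four (Lp.memLp _)).add
    (integrable_pow_four (Lp.memLp _))).div_const 2) ?_
  filter_upwards [Lp.coeFn_smul (2⁻¹ : ℝ) (x + y), Lp.coeFn_smul (2⁻¹ : ℝ) (x - y),
    Lp.coeFn_add x y, Lp.coeFn_sub x y] with t h1 h2 h3 h4
  rw [h1, h2]
  simp only [Pi.smul_apply, smul_eq_mul]
  rw [h3, h4]
  simp only [Pi.add_apply, Pi.sub_apply]
  nlinarith [sq_nonneg (x t ^ 2 - y t ^ 2)]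

theorem memLp_two_of_memLp_four [IsFiniteMeasure μ] {f : Ω → ℝ} (hf : MemLp f 4 μ) :
    MemLp f 2 μ :=
  hf.mono_exponent (by norm_num)

/-- The inclusion of `L⁴` in `L²` over a probability space. -/
noncomputable def inclL4 (μ : Measure Ω) [IsProbabilityMeasure μ] : Lp ℝ 4 μ →L[ℝ] Lp ℝ 2 μ :=
  LinearMap.mkContinuous
    { toFun := fun z => (memLp_two_of_memLp_four (Lp.memLp z)).toLp z
      map_add' := fun x y => by
        rw [← MemLp.toLp_add]
        exact MemLp.toLp_congr _ _ (Lp.coeFn_add x y)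
      map_smul' := fun t x => by
        rw [RingHom.id_apply, ← MemLp.toLp_const_smul]
        exact MemLp.toLp_congr _ _ (Lp.coeFn_smul t x) } 1 fun z => by
    rw [LinearMap.coe_mk, AddHom.coe_mk, Lp.norm_toLp, one_mul, Lp.norm_def]
    exact ENNReal.toReal_mono (Lp.memLp z).2.ne
      (eLpNorm_le_eLpNorm_of_exponent_le (by norm_num) (Lp.aestronglyMeasurable z))

theorem inclL4_apply [IsProbabilityMeasure μ] (z : Lp ℝ 4 μ) :
    inclL4 μ z = (memLp_two_of_memLp_four (Lp.memLp z)).toLp z := rfl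

theorem norm_inclL4_le [IsProbabilityMeasure μ] (z : Lp ℝ 4 μ) : ‖inclL4 μ z‖ ≤ ‖z‖ := by
  simpa using (inclL4 μ).le_of_opNorm_le (LinearMap.mkContinuous_norm_le _ zero_le_one _) z

/-- The mixed products of degree four of two functions in `L⁴` are integrable. -/
theorem integrable_pow_mul_pow {f g : Ω → ℝ} (hf : MemLp f 4 μ) (hg : MemLp g 4 μ) {i j : ℕ}
    (hij : i + j = 4) : Integrable (fun x => f x ^ i * g x ^ j) μ := by
  refine ((integrable_pow_four hf).add (integrable_pow_four hg)).mono'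
    ((hf.1.pow i).mul (hg.1.pow j)) (Eventually.of_forall fun x => ?_)
  rw [Pi.add_apply, norm_mul, norm_pow, norm_pow, Real.norm_eq_abs, Real.norm_eq_abs,
    ← (show Even 4 by decide).pow_abs (f x), ← (show Even 4 by decide).pow_abs (g x)]
  have ha := abs_nonneg (f x)
  have hb := abs_nonneg (g x)
  rcases le_total |f x| |g x| with h | h
  · calc |f x| ^ i * |g x| ^ j ≤ |g x| ^ i * |g x| ^ j := by gcongr
      _ = |g x| ^ 4 := by rw [← pow_add, hij]
      _ ≤ _ := by linarith [pow_nonneg ha 4]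
  · calc |f x| ^ i * |g x| ^ j ≤ |f x| ^ i * |f x| ^ j := by gcongr
      _ = |f x| ^ 4 := by rw [← pow_add, hij]
      _ ≤ _ := by linarith [pow_nonneg hb 4]

/-- The directional derivative of `∫ f⁴ / 4`. -/
theorem hasDerivAt_integral_pow_four {f g : Ω → ℝ} (hf : MemLp f 4 μ) (hg : MemLp g 4 μ) :
    HasDerivAt (fun s : ℝ => (∫ x, (f x + s * g x) ^ 4 ∂μ) / 4) (∫ x, f x ^ 3 * g x ∂μ) 0 := by
  have i0 := integrable_pow_four hf
  have i1 := integrable_pow_mul_pow hf hg (i := 3) (j := 1) rfl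
  have i2 := integrable_pow_mul_pow hf hg (i := 2) (j := 2) rfl
  have i3 := integrable_pow_mul_pow hf hg (i := 1) (j := 3) rfl
  have i4 := integrable_pow_four hg
  have e : ∀ s : ℝ, (∫ x, (f x + s * g x) ^ 4 ∂μ) / 4 = (∫ x, f x ^ 4 ∂μ) / 4 +
      s * ∫ x, f x ^ 3 * g x ^ 1 ∂μ + s ^ 2 * (3 / 2 * ∫ x, f x ^ 2 * g x ^ 2 ∂μ +
        s * (∫ x, f x ^ 1 * g x ^ 3 ∂μ) + s ^ 2 * (1 / 4 * ∫ x, g x ^ 4 ∂μ)) := fun s => by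
    have e1 : ∀ x, (f x + s * g x) ^ 4 = f x ^ 4 + (4 * s) * (f x ^ 3 * g x ^ 1) +
        (6 * s ^ 2) * (f x ^ 2 * g x ^ 2) + (4 * s ^ 3) * (f x ^ 1 * g x ^ 3) +
        s ^ 4 * g x ^ 4 := fun x => by ring
    simp_rw [e1]
    have j1 := i1.const_mul (4 * s)
    have j2 := i2.const_mul (6 * s ^ 2)
    have j3 := i3.const_mul (4 * s ^ 3)
    rw [integral_add (by exact ((i0.add j1).add j2).add j3) (i4.const_mul _),
      integral_add (by exact (i0.add j1).add j2) j3, integral_add (by exact i0.add j1) j2,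
      integral_add i0 j1]
    simp only [integral_const_mul]
    ring
  simp_rw [e, pow_one]
  set a := ∫ x, f x ^ 3 * g x ∂μ
  refine HasDerivAt.congr_deriv (((hasDerivAt_const (0 : ℝ) _).add
    ((hasDerivAt_id (0 : ℝ)).mul_const a)).add (((hasDerivAt_id (0 : ℝ)).pow 2).mul
    ((((hasDerivAt_id (0 : ℝ)).mul_const _).const_add _).add
    (((hasDerivAt_id (0 : ℝ)).pow 2).mul_const _)))) ?_
  simp

end Quartic

section Minimizer

variable {T : ℝ} [hT : Fact (0 < T)]

variable (T) in
/-- The operator `z ↦ z (· + T/2) + z` on `L⁴` of the circle. -/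
noncomputable def shiftAddId :
    Lp ℝ 4 (haarAddCircle (T := T)) →L[ℝ] Lp ℝ 4 (haarAddCircle (T := T)) :=
  (Lp.compMeasurePreservingₗᵢ (E := ℝ) (p := 4) ℝ (fun x => x + halfPeriod T)
    (measurePreserving_add_right haarAddCircle (halfPeriod T))).toContinuousLinearMap +
      ContinuousLinearMap.id ℝ _

variable (T) in
/-- The closed subspace of `L⁴` of the circle of functions with `z (t + T/2) = - z t`. -/
noncomputable def antiperiodicL4 : Submodule ℝ (Lp ℝ 4 (haarAddCircle (T := T))) :=
  (shiftAddId T : Lp ℝ 4 (haarAddCircle (T := T)) →ₗ[ℝ] Lp ℝ 4 (haarAddCircle (T := T))).ker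

theorem mem_antiperiodicL4 {z : Lp ℝ 4 (haarAddCircle (T := T))} :
    z ∈ antiperiodicL4 T ↔ ∀ᵐ x ∂haarAddCircle, z (x + halfPeriod T) = -z x := by
  have hmp := measurePreserving_add_right (haarAddCircle (T := T)) (halfPeriod T)
  have : z ∈ antiperiodicL4 T ↔ Lp.compMeasurePreserving _ hmp z = -z := by
    rw [← add_eq_zero_iff_eq_neg]
    exact Iff.rfl
  rw [this, Lp.ext_iff]
  constructor
  · intro h
    filter_upwards [h, Lp.coeFn_compMeasurePreserving z hmp, Lp.coeFn_neg z] with x h1 h2 h3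
    rw [h2, h3] at h1
    exact h1
  · intro h
    filter_upwards [h, Lp.coeFn_compMeasurePreserving z hmp, Lp.coeFn_neg z] with x h1 h2 h3
    rw [h2, h3]
    exact h1

theorem isClosed_antiperiodicL4 :
    IsClosed (antiperiodicL4 T : Set (Lp ℝ 4 (haarAddCircle (T := T)))) :=
  (shiftAddId T).isClosed_ker

theorem inner_casBasis_inclL4 (z : Lp ℝ 4 (haarAddCircle (T := T))) (n : ℤ) :
    inner ℝ (casBasis n) (inclL4 haarAddCircle z) = casCoeff z n := by
  rw [inclL4_apply, inner_casBasis]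

/-- The functional `∫ z⁴ / 4 + ∑ c n * (casCoeff z n)²` has a nonzero minimizer among the
antiperiodic functions in `L⁴`, which satisfies the Euler-Lagrange equation. -/
theorem exists_critical_point (c : ℤ → ℝ) (hc : Tendsto c cofinite (nhds 0)) {n₀ : ℤ}
    (hn₀ : Odd n₀) (hneg : c n₀ < 0) :
    ∃ z : AddCircle T → ℝ, MemLp z 4 haarAddCircle ∧
      (∀ᵐ x ∂haarAddCircle, z (x + halfPeriod T) = -z x) ∧ ¬ z =ᵐ[haarAddCircle] 0 ∧
      ∀ h : AddCircle T → ℝ, MemLp h 4 haarAddCircle →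
        (∀ᵐ x ∂haarAddCircle, h (x + halfPeriod T) = -h x) →
        (∫ x, z x ^ 3 * h x ∂haarAddCircle) + 2 * ∑' n, c n * (casCoeff z n * casCoeff h n) = 0 := by
  obtain ⟨K, hK⟩ : ∃ K, ∀ n, |c n| ≤ K := by
    have h := hc.abs
    rw [abs_zero] at h
    obtain ⟨K, hK⟩ := h.bddAbove_range_of_cofinite
    exact ⟨K, fun n => hK ⟨n, rfl⟩⟩
  have : CompleteSpace (antiperiodicL4 T) := isClosed_antiperiodicL4.completeSpace_coe
  set b := casBasis (T := T)
  set B : Lp ℝ 4 (haarAddCircle (T := T)) → Lp ℝ 4 (haarAddCircle (T := T)) → ℝ := fun x y =>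
    diagonalForm b c (inclL4 haarAddCircle x) (inclL4 haarAddCircle y) with hB
  have hBadd : ∀ x y : Lp ℝ 4 (haarAddCircle (T := T)), ∀ t : ℝ, B (x + t • y) (x + t • y) =
      B x x + 2 * t * B x y + t ^ 2 * B y y := fun x y t => by
    simp only [hB, map_add, map_smul]
    exact diagonalForm_add_smul_self b hK _ _ t
  have hB0 : ∀ (y : Lp ℝ 4 (haarAddCircle (T := T))) (t : ℝ), B (t • y) (t • y) = t ^ 2 * B y y :=
    fun y t => by
      simp only [hB, map_smul]
      rw [diagonalForm_smul_left, diagonalForm_comm, diagonalForm_smul_left]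
      ring
  obtain ⟨z, hz⟩ := exists_forall_quartic_add_quadratic_le (E := antiperiodicL4 T)
    (fun z => B z z) (fun x y => clarkson_L4 (x : Lp ℝ 4 (haarAddCircle (T := T))) y)
    (fun x y => by
      simp only [Submodule.coe_smul, Submodule.coe_add, Submodule.coe_sub]
      rw [hB0, hB0]
      have h1 := hBadd x y 1
      have h2 := hBadd x y (-1)
      rw [one_smul] at h1
      rw [neg_smul, one_smul, ← sub_eq_add_neg] at h2
      rw [h1, h2]
      ring)
    ((continuous_diagonalForm_self b hK).comp
      ((inclL4 haarAddCircle).continuous.comp continuous_subtype_val)) K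
    (fun x => by
      refine (abs_diagonalForm_self_le b hK _).trans ?_
      have hK0 : 0 ≤ K := (abs_nonneg _).trans (hK 0)
      have := norm_inclL4_le (x : Lp ℝ 4 (haarAddCircle (T := T)))
      rw [Submodule.coe_norm]
      gcongr)
    (fun u R hu => by
      obtain ⟨φ, hφ, h⟩ := exists_subseq_diagonalForm_sub_lt b hc
        (fun m => inclL4 haarAddCircle (u m : Lp ℝ 4 (haarAddCircle (T := T)))) R
        (fun m => (norm_inclL4_le _).trans (hu m))
      refine ⟨φ, hφ, fun ε hε => ?_⟩
      obtain ⟨N, hN⟩ := h ε hε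
      refine ⟨N, fun m hm n hn => ?_⟩
      simp only [Submodule.coe_smul, Submodule.coe_sub]
      rw [hB0]
      have h1 := hN m hm n hn
      rw [← map_sub] at h1
      rw [abs_mul, abs_of_nonneg (by positivity)]
      have h2 : |B ((u (φ m) : Lp ℝ 4 (haarAddCircle (T := T))) - u (φ n))
        (u (φ m) - u (φ n))| < ε := h1
      linarith [abs_nonneg (B ((u (φ m) : Lp ℝ 4 (haarAddCircle (T := T))) - u (φ n))
        (u (φ m) - u (φ n)))])
  refine ⟨z, Lp.memLp _, mem_antiperiodicL4.1 z.2, fun h0 => ?_, fun h hh hanti => ?_⟩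
  · have hz0 : (z : Lp ℝ 4 (haarAddCircle (T := T))) = 0 := (Lp.eq_zero_iff_ae_eq_zero).2 h0
    have hcas := memLp_continuousMap (T := T) (cas n₀) 4
    set e := hcas.toLp (cas n₀) with he
    have hemem : e ∈ antiperiodicL4 T := by
      rw [mem_antiperiodicL4]
      have hmp := measurePreserving_add_right (haarAddCircle (T := T)) (halfPeriod T)
      filter_upwards [hcas.coeFn_toLp, hmp.quasiMeasurePreserving.ae hcas.coeFn_toLp]
        with x h1 h2
      rw [h1, h2, cas_add_halfPeriod_of_odd hn₀]
    have hBe : B e e = c n₀ := by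
      have hcoef : ∀ n, casCoeff (e : AddCircle T → ℝ) n = if n = n₀ then 1 else 0 := fun n => by
        rw [← integral_cas_mul_cas (T := T), casCoeff]
        refine integral_congr_ae ?_
        filter_upwards [hcas.coeFn_toLp] with x h1
        rw [h1]
      simp only [hB, diagonalForm, b, inner_casBasis_inclL4, hcoef]
      rw [tsum_eq_single n₀ fun n hn => by simp [hn]]
      simp
    set A := ‖e‖ ^ 4 with hA
    have hA0 : 0 ≤ A := by positivity
    -- for this `s` the negative quadratic term dominates the quartic one
    set s := Real.sqrt (-c n₀ / (A + 1)) with hs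
    have hs2 : s ^ 2 = -c n₀ / (A + 1) := Real.sq_sqrt (div_nonneg (by linarith) (by linarith))
    have h1 := hz (s • ⟨e, hemem⟩)
    simp only [Submodule.coe_norm, Submodule.coe_smul, hz0] at h1
    have hB00 : B 0 0 = 0 := by simpa using hB0 0 0
    rw [hB0, hBe, hB00, norm_smul, mul_pow, ← hA, Real.norm_eq_abs,
      (show Even 4 by decide).pow_abs, show s ^ 4 = (s ^ 2) ^ 2 by ring, hs2] at h1
    simp only [norm_zero] at h1
    have h2 : (-c n₀ / (A + 1)) ^ 2 * A / 4 + -c n₀ / (A + 1) * c n₀ =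
        c n₀ ^ 2 / (A + 1) ^ 2 * (A / 4 - (A + 1)) := by
      field_simp
      ring
    rw [h2] at h1
    have h3 : 0 < c n₀ ^ 2 / (A + 1) ^ 2 := by
      have : c n₀ ≠ 0 := hneg.ne
      positivity
    nlinarith
  · have hhmem : hh.toLp h ∈ antiperiodicL4 T := by
      rw [mem_antiperiodicL4]
      have hmp := measurePreserving_add_right (haarAddCircle (T := T)) (halfPeriod T)
      filter_upwards [hh.coeFn_toLp, hmp.quasiMeasurePreserving.ae hh.coeFn_toLp, hanti]
        with x h1 h2 h3
      rw [h1, h2, h3]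
    set y := hh.toLp h with hy
    have hcoef : ∀ n, casCoeff h n = casCoeff (y : AddCircle T → ℝ) n := fun n => by
      refine integral_congr_ae ?_
      filter_upwards [hh.coeFn_toLp] with x h1
      rw [h1]
    have hBy : B z y = ∑' n, c n * (casCoeff z.1 n * casCoeff h n) := by
      simp only [hB, diagonalForm, b, inner_casBasis_inclL4, hcoef]
    have hint : ∀ s : ℝ, ‖(z : Lp ℝ 4 (haarAddCircle (T := T))) + s • y‖ ^ 4 =
        ∫ x, (z.1 x + s * h x) ^ 4 ∂haarAddCircle := fun s => by
      rw [norm_pow_four_eq_integral]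
      refine integral_congr_ae ?_
      filter_upwards [hh.coeFn_toLp, Lp.coeFn_add z.1 (s • y), Lp.coeFn_smul s y] with x h1 h2 h3
      rw [h2, Pi.add_apply, h3, Pi.smul_apply, h1, smul_eq_mul]
    have hd1 := hasDerivAt_integral_pow_four (Lp.memLp z.1) hh
    have hd2 : HasDerivAt (fun s : ℝ => B z z + 2 * s * B z y + s ^ 2 * B y y) (2 * B z y) 0 := by
      refine HasDerivAt.congr_deriv ((((hasDerivAt_id (0 : ℝ)).const_mul 2).mul_const
        (B z y)).const_add (B z z) |>.add (((hasDerivAt_id (0 : ℝ)).pow 2).mul_const (B y y))) ?_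
      simp
    have hmin : IsLocalMin (fun s : ℝ => (∫ x, (z.1 x + s * h x) ^ 4 ∂haarAddCircle) / 4 +
        (B z z + 2 * s * B z y + s ^ 2 * B y y)) 0 := by
      refine Eventually.of_forall fun s => ?_
      have h1 := hz (z + s • ⟨y, hhmem⟩)
      simp only [Submodule.coe_norm, Submodule.coe_smul, Submodule.coe_add] at h1
      rw [hBadd, hint] at h1
      have h2 := hint 0
      rw [zero_smul, add_zero] at h2
      rw [h2] at h1
      simpa using h1
    have := hmin.hasDerivAt_eq_zero (hd1.add hd2)
    rw [hBy] at this
    exact this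

end Minimizer

/-! ### Decaying solutions on the half-line -/

section Profiles

theorem uIcc_subset_Ici_zero {a b : ℝ} (ha : 0 ≤ a) (hb : 0 ≤ b) : uIcc a b ⊆ Ici 0 :=
  fun _ hx => (le_min ha hb).trans hx.1

theorem intervalIntegrable_of_memLp_Ici {E : Type*} [NormedAddCommGroup E] {v : ℝ → E}
    (hv : MemLp v 2 (volume.restrict (Ici 0))) {a b : ℝ} (ha : 0 ≤ a) (hb : 0 ≤ b) :
    IntervalIntegrable v volume a b := by
  rw [intervalIntegrable_iff]
  have hsub : uIoc a b ⊆ Ici 0 := uIoc_subset_uIcc.trans (uIcc_subset_Ici_zero ha hb)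
  have : IsFiniteMeasure (volume.restrict (uIoc a b)) := ⟨by simp [uIoc]⟩
  exact (hv.mono_measure (Measure.restrict_mono hsub le_rfl)).integrable (by norm_num)

/-- Functions which are primitives on `[0, ∞)` of a square integrable function are continuous
there. -/
theorem continuousOn_of_primitive {u v : ℝ → ℝ} (hv : MemLp v 2 (volume.restrict (Ici 0)))
    (huv : ∀ a ∈ Ici (0 : ℝ), ∀ b ∈ Ici (0 : ℝ), u b - u a = ∫ x in a..b, v x) :
    ContinuousOn u (Ici 0) := by
  intro x hx
  have hx0 : (0 : ℝ) ≤ x := hx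
  have h1 : ContinuousOn (fun y => ∫ t in (0 : ℝ)..y, v t) (uIcc 0 (x + 1)) :=
    intervalIntegral.continuousOn_primitive_interval' (b₁ := 0) (b₂ := x + 1)
      (intervalIntegrable_of_memLp_Ici hv le_rfl (by linarith)) left_mem_uIcc
  have h2 : ContinuousOn (fun y => u 0 + ∫ t in (0 : ℝ)..y, v t) (Icc 0 (x + 1)) := by
    rw [uIcc_of_le (by linarith)] at h1
    exact continuousOn_const.add h1
  have h3 : ContinuousOn u (Icc 0 (x + 1)) := h2.congr fun y hy => by
    simp only
    rw [← huv 0 self_mem_Ici y hy.1]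
    ring
  refine (h3 x ⟨hx0, by linarith⟩).mono_of_mem_nhdsWithin ?_
  rw [← Ici_inter_Iic]
  exact inter_mem_nhdsWithin _ (Iic_mem_nhds (by linarith))

theorem HasH2Derivs.continuousOn {φ φ' φ'' : ℝ → ℝ} (h : HasH2Derivs (Ici 0) φ φ' φ'') :
    ContinuousOn φ (Ici 0) :=
  continuousOn_of_primitive h.memLp_fst h.integral_fst

theorem HasH2Derivs.continuousOn_fst {φ φ' φ'' : ℝ → ℝ} (h : HasH2Derivs (Ici 0) φ φ' φ'') :
    ContinuousOn φ' (Ici 0) :=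
  continuousOn_of_primitive h.memLp_snd h.integral_snd

theorem HasH2Derivs.derivWithin_zero {φ φ' φ'' : ℝ → ℝ} (h : HasH2Derivs (Ici 0) φ φ' φ'') :
    derivWithin φ (Ici 0) 0 = φ' 0 := by
  have h1 : HasDerivWithinAt (fun y => ∫ t in (0 : ℝ)..y, φ' t) (φ' 0) (Ici 0) 0 := by
    refine intervalIntegral.integral_hasDerivWithinAt_right (by simp) ?_
      (h.continuousOn_fst 0 self_mem_Ici |>.mono Ioi_subset_Ici_self)
    refine ⟨Ici 0, Filter.mem_of_superset self_mem_nhdsWithin Ioi_subset_Ici_self, ?_⟩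
    exact h.memLp_fst.1
  have h2 : HasDerivWithinAt φ (φ' 0) (Ici 0) 0 := by
    refine (h1.const_add (φ 0)).congr (fun y hy => ?_) ?_
    · rw [← h.integral_fst 0 self_mem_Ici y hy]
      ring
    · simp
  exact h2.derivWithin (uniqueDiffWithinAt_Ici 0)

theorem integrable_exp_neg_mul_abs {c : ℝ} (hc : 0 < c) :
    Integrable fun x : ℝ => Real.exp (-c * |x|) := by
  rw [← integrableOn_univ, ← Iic_union_Ioi (a := (0 : ℝ))]
  refine IntegrableOn.union ?_ ?_
  · refine (integrableOn_exp_mul_Iic hc 0).congr_fun (fun x hx => ?_) measurableSet_Iic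
    simp only
    rw [abs_of_nonpos hx]
    ring_nf
  · refine (exp_neg_integrableOn_Ioi 0 hc).congr_fun (fun x hx => ?_) measurableSet_Ioi
    simp only
    rw [abs_of_pos hx]

theorem memLp_exp_neg_mul_abs {c : ℝ} (hc : 0 < c) :
    MemLp (fun x : ℝ => Real.exp (-c * |x|)) 2 volume := by
  rw [memLp_two_iff_integrable_sq (by fun_prop)]
  refine (integrable_exp_neg_mul_abs (c := 2 * c) (by linarith)).congr
    (Eventually.of_forall fun x => ?_)
  simp only
  rw [sq, ← Real.exp_add]
  ring_nf

/-- The sign function with value `-1` at `0`. -/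
noncomputable def sgn (x : ℝ) : ℝ := if 0 < x then 1 else -1

theorem measurable_sgn : Measurable sgn :=
  Measurable.ite measurableSet_Ioi measurable_const measurable_const

theorem sgn_of_pos {x : ℝ} (hx : 0 < x) : sgn x = 1 := if_pos hx

theorem sgn_neg_of_pos {x : ℝ} (hx : 0 < x) : sgn (-x) = -1 := if_neg (by linarith)

theorem abs_sgn (x : ℝ) : |sgn x| = 1 := by
  unfold sgn
  split_ifs <;> simp

theorem sgn_neg {x : ℝ} (hx : x ≠ 0) : sgn (-x) = -sgn x := by
  rcases lt_or_gt_of_ne hx with h | h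
  · rw [sgn_of_pos (by linarith), sgn, if_neg (by linarith), neg_neg]
  · rw [sgn_of_pos h, sgn_neg_of_pos h]

/-- Existence of the decaying solution. If `v` is the odd solution of `L_k v = - L_k e^{-|x|}` on
`(0, ∞)`, then `v(0) = 0` and `v + e^{-x}` is the solution sought; `v` exists because `0` lies in
the resolvent set of the Dirichlet operator. -/
theorem exists_isDecayingSolution {g : ℝ → ℝ} {ω : ℝ} {k : ℕ} (hg : MemLp g ∞ volume)
    (hg_even : ∀ᵐ x : ℝ, g (-x) = g x) (h0 : (0 : ℂ) ∉ spectrum (dirichletL g ω k)) :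
    ∃ φ : ℝ → ℝ, IsDecayingSolution g ω k φ := by
  set κ := (k : ℝ) ^ 2 * ω ^ 2 with hκ
  -- the odd extension of `(e^{-x})'' + κ g e^{-x}`
  set r : ℝ → ℝ := fun x => sgn x * ((1 + κ * g x) * Real.exp (-1 * |x|)) with hr
  have hr2 : MemLp r 2 volume := by
    have h1 : MemLp (fun x => (1 + κ * g x) * Real.exp (-1 * |x|)) 2 volume :=
      MemLp.mul' (memLp_exp_neg_mul_abs one_pos) ((memLp_top_const (1 : ℝ)).add (hg.const_mul κ))
    refine h1.of_le (measurable_sgn.aestronglyMeasurable.mul h1.1) (Eventually.of_forall fun x => ?_)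
    rw [norm_mul, Real.norm_eq_abs, abs_sgn, one_mul]
  have hrC : MemLp (fun x => ((r x : ℝ) : ℂ)) 2 volume := hr2.ofReal
  have hneg := (Measure.measurePreserving_neg (volume : Measure ℝ)).quasiMeasurePreserving
  have hodd : hrC.toLp _ ∈ oddL2 := by
    change ∀ᵐ x : ℝ, hrC.toLp _ (-x) = -hrC.toLp _ x
    filter_upwards [hrC.coeFn_toLp, hneg.ae hrC.coeFn_toLp, hg_even,
      Measure.ae_ne volume (0 : ℝ)] with x h1 h2 h3 h4
    rw [h1, h2]
    simp only [hr]
    rw [h3, abs_neg, sgn_neg h4]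
    push_cast
    ring
  rw [spectrum, notMem_compl_iff] at h0
  obtain ⟨u, hu⟩ := h0.1.2 ⟨_, hodd⟩
  simp only [zero_smul, sub_zero] at hu
  have hgraph := (dirichletL g ω k).mem_graph u
  rw [dirichletL_graph, hu] at hgraph
  obtain ⟨φ, φ', φ'', h, h1, h2⟩ := hgraph
  change ((u : oddL2) : L2) =ᵐ[volume] φ at h1
  change hrC.toLp _ =ᵐ[volume] _ at h2
  have hint : ∀ {f : ℝ → ℂ}, MemLp f 2 (volume.restrict univ) → ∀ a b : ℝ,
      IntervalIntegrable f volume a b := fun {f} hf a b => by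
    rw [Measure.restrict_univ] at hf
    exact ((hf.locallyIntegrable (by norm_num)).integrableOn_isCompact
      isCompact_uIcc).intervalIntegrable
  have hcont : Continuous φ := by
    have hu : φ = fun b => φ 0 + ∫ x in (0 : ℝ)..b, φ' x := by
      funext b
      rw [← h.integral_fst 0 (mem_univ _) b (mem_univ _)]
      ring
    rw [hu]
    exact continuous_const.add (intervalIntegral.continuous_primitive (hint h.memLp_fst) 0)
  have hφ0 : φ 0 = 0 := by
    have hu : ∀ᵐ x : ℝ, ((u : oddL2) : L2) (-x) = -((u : oddL2) : L2) x := (u : oddL2).2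
    have hae : (fun x => φ (-x)) =ᵐ[volume] fun x => -φ x := by
      filter_upwards [hu, h1, hneg.ae h1] with x h3 h4 h5
      rw [← h4, ← h5, h3]
    have := (Continuous.ae_eq_iff_eq volume (hcont.comp continuous_neg) hcont.neg).1 hae
    have h6 : φ (-0) = -φ 0 := congrFun this 0
    rw [neg_zero] at h6
    exact self_eq_neg.1 h6
  have hsub : ∀ {f : ℝ → ℂ}, MemLp f 2 (volume.restrict univ) →
      MemLp (fun x => (f x).re) 2 (volume.restrict (Ici 0)) := fun {f} hf => by
    rw [Measure.restrict_univ] at hf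
    exact hf.re.restrict (Ici 0)
  have hexp : ∀ s : ℝ, MemLp (fun x : ℝ => s * Real.exp (-x)) 2 (volume.restrict (Ici 0)) := fun s =>
    (((memLp_exp_neg_mul_abs one_pos).restrict (Ici 0)).ae_eq (by
      filter_upwards [ae_restrict_mem measurableSet_Ici] with x hx
      rw [abs_of_nonneg hx, neg_one_mul])).const_mul s
  have hre : ∀ {f F : ℝ → ℂ}, MemLp f 2 (volume.restrict univ) →
      (∀ a ∈ (univ : Set ℝ), ∀ b ∈ (univ : Set ℝ), F b - F a = ∫ x in a..b, f x) →
      ∀ s a b : ℝ, ((F b).re + s * Real.exp (-b)) - ((F a).re + s * Real.exp (-a)) =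
        ∫ x in a..b, ((f x).re + -s * Real.exp (-x)) := fun {f F} hf hF s a b => by
    have e1 : ∫ x in a..b, (f x).re = (F b - F a).re := by
      rw [hF a (mem_univ _) b (mem_univ _)]
      exact Complex.reCLM.intervalIntegral_comp_comm (hint hf a b)
    have hc : Continuous fun x : ℝ => -s * Real.exp (-x) := by fun_prop
    have e2 : ∫ x in a..b, -s * Real.exp (-x) = s * Real.exp (-b) - s * Real.exp (-a) := by
      refine intervalIntegral.integral_eq_sub_of_hasDerivAt (f := fun x => s * Real.exp (-x))
        (fun x _ => ?_) (hc.intervalIntegrable _ _)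
      refine HasDerivAt.congr_deriv ((hasDerivAt_neg x).exp.const_mul s) ?_
      ring
    rw [intervalIntegral.integral_add, e1, e2, Complex.sub_re]
    · ring
    · exact ⟨Complex.reCLM.integrable_comp (hint hf a b).1,
        Complex.reCLM.integrable_comp (hint hf a b).2⟩
    · exact hc.intervalIntegrable _ _
  refine ⟨fun x => (φ x).re + 1 * Real.exp (-x), ⟨fun x => (φ' x).re + -1 * Real.exp (-x),
    fun x => (φ'' x).re + 1 * Real.exp (-x), ⟨(hsub h.memLp).add (hexp 1),
    (hsub h.memLp_fst).add (hexp _), (hsub h.memLp_snd).add (hexp 1),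
    fun a _ b _ => hre h.memLp_fst h.integral_fst 1 a b, fun a _ b _ => ?_⟩, ?_⟩, ?_⟩
  · have := hre h.memLp_snd h.integral_snd (-1) a b
    simpa only [neg_neg] using this
  · rw [ae_restrict_iff' measurableSet_Ioi]
    filter_upwards [h2, hrC.coeFn_toLp] with x h3 h4 hx
    rw [h4] at h3
    have h5 := congrArg Complex.re h3
    simp only [hr, Complex.ofReal_re, Complex.sub_re, Complex.neg_re, Complex.re_ofReal_mul] at h5
    rw [sgn_of_pos hx, abs_of_pos hx, neg_one_mul, one_mul] at h5
    linear_combination -h5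
  · simp [hφ0]

theorem ae_abs_le_of_memLp_top {g : ℝ → ℝ} (hg : MemLp g ∞ volume) :
    ∃ N : ℝ, 0 ≤ N ∧ ∀ᵐ x, |g x| ≤ N := by
  refine ⟨(eLpNorm g ∞ volume).toReal, ENNReal.toReal_nonneg, ?_⟩
  have h := ae_le_eLpNormEssSup (f := g) (μ := volume)
  filter_upwards [h] with x hx
  have := ENNReal.toReal_mono hg.2.ne (by simpa using hx)
  simpa using this

/-- The restriction to `[0, ∞)` of the spatial profile of a mode: a solution of
`f'' = - κ g f` with `f 0 = 1`, with exponential decay of `f` and `f'`. -/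
structure IsProfile (g : ℝ → ℝ) (κ ρ M A : ℝ) (f f' f'' : ℝ → ℝ) : Prop where
  hasH2Derivs : HasH2Derivs (Ici 0) f f' f''
  snd_eq : ∀ᵐ x ∂(volume.restrict (Ioi 0)), f'' x = -(κ * g x * f x)
  apply_zero : f 0 = 1
  bound : ∀ x, 0 ≤ x → |f x| ≤ M * Real.exp (-ρ * x)
  bound_fst : ∀ x, 0 ≤ x → |f' x| ≤ A * Real.exp (-ρ * x)

/-- Landau's inequality on `[x, x + 1/k]` turns the uniform bound for the solutions into a
bound of order `k` for their derivatives. -/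
theorem IsDecayingSolution.exists_isProfile {g : ℝ → ℝ} {ω ρ M N : ℝ} {k : ℕ} {φ : ℝ → ℝ}
    (hρ : 0 < ρ) (hk : 0 < k) (hN0 : 0 ≤ N) (hN : ∀ᵐ x, |g x| ≤ N)
    (h : IsDecayingSolution g ω k φ) (hM : ∀ x, 0 ≤ x → |φ x| ≤ M * Real.exp (-ρ * x)) :
    ∃ φ' φ'', IsProfile g ((k : ℝ) ^ 2 * ω ^ 2) ρ M ((2 * M + ω ^ 2 * N * M) * k) φ φ' φ'' ∧
      derivWithin φ (Ici 0) 0 = φ' 0 := by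
  obtain ⟨⟨φ', φ'', h2, heq⟩, h1⟩ := h
  refine ⟨φ', φ'', ⟨h2, ?_, h1, hM, fun x hx => ?_⟩, h2.derivWithin_zero⟩
  · filter_upwards [heq] with x hx
    linarith
  have hM0 : 0 ≤ M := by
    have := (abs_nonneg _).trans (hM 0 le_rfl)
    simpa using this
  have hk' : (0 : ℝ) < k := by exact_mod_cast hk
  set E := Real.exp (-ρ * x) with hE
  have hE0 : 0 < E := Real.exp_pos _
  have hmono : ∀ s, x ≤ s → Real.exp (-ρ * s) ≤ E := fun s hs => by
    rw [hE, Real.exp_le_exp]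
    nlinarith
  have h3 : ∀ᵐ s, x < s → ‖φ'' s‖ ≤ (k : ℝ) ^ 2 * ω ^ 2 * N * M * E := by
    rw [ae_restrict_iff' measurableSet_Ioi] at heq
    filter_upwards [heq, hN] with s h4 h5 hs
    have hs0 : 0 < s := hx.trans_lt hs
    have h6 : φ'' s = -((k : ℝ) ^ 2 * ω ^ 2 * (g s * φ s)) := by
      linear_combination -(h4 hs0)
    rw [h6, norm_neg, norm_mul, Real.norm_of_nonneg (by positivity : 0 ≤ (k : ℝ) ^ 2 * ω ^ 2),
      norm_mul, Real.norm_eq_abs, Real.norm_eq_abs]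
    have h7 := (hM s hs0.le).trans (mul_le_mul_of_nonneg_left (hmono s hs.le) hM0)
    calc (k : ℝ) ^ 2 * ω ^ 2 * (|g s| * |φ s|) ≤ (k : ℝ) ^ 2 * ω ^ 2 * (N * (M * E)) := by gcongr
      _ = _ := by ring
  -- the length of the interval balancing `2 M / η` against `k² ω² N M η`
  set η : ℝ := 1 / k with hη
  have hη0 : 0 < η := by positivity
  have h4 : ∀ s ∈ uIoc x (x + η), ‖φ' s - φ' x‖ ≤ (k : ℝ) ^ 2 * ω ^ 2 * N * M * E * η := by
    intro s hs
    rw [uIoc_of_le (by linarith)] at hs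
    rw [h2.integral_snd x hx s (hx.trans hs.1.le)]
    refine (intervalIntegral.norm_integral_le_of_norm_le_const_ae (a := x) (b := s)
      (C := (k : ℝ) ^ 2 * ω ^ 2 * N * M * E) ?_).trans ?_
    · filter_upwards [h3] with t ht hts
      rw [uIoc_of_le hs.1.le] at hts
      exact ht hts.1
    · rw [abs_of_pos (by linarith [hs.1])]
      have : s - x ≤ η := by linarith [hs.2]
      gcongr
  have h5 := intervalIntegral.norm_integral_le_of_norm_le_const h4
  have hx' : 0 ≤ x + η := by linarith
  rw [intervalIntegral.integral_sub (intervalIntegrable_of_memLp_Ici h2.memLp_fst hx hx')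
    intervalIntegrable_const, ← h2.integral_fst x hx _ hx', intervalIntegral.integral_const,
    add_sub_cancel_left, abs_of_pos hη0, smul_eq_mul, Real.norm_eq_abs] at h5
  have h6 := hM x hx
  have h7 := (hM _ hx').trans (mul_le_mul_of_nonneg_left (hmono (x + η) (by linarith)) hM0)
  have h8 : |η * φ' x| ≤ (k : ℝ) ^ 2 * ω ^ 2 * N * M * E * η * η + M * E + M * E := by
    have e : η * φ' x = -(φ (x + η) - φ x - η * φ' x) + φ (x + η) - φ x := by ring
    rw [e]
    refine (abs_sub _ _).trans (add_le_add ((abs_add_le _ _).trans (add_le_add ?_ h7)) h6)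
    rw [abs_neg]
    exact h5
  rw [abs_mul, abs_of_pos hη0, hη, one_div_mul_eq_div, div_le_iff₀ hk'] at h8
  refine h8.trans (le_of_eq ?_)
  field_simp
  ring

end Profiles

/-! ### Even extension to the line -/

section Line

/-- `χ` is a continuously differentiable function on `ℝ` with derivative `χ'` which vanishes
outside a bounded set. -/
structure IsLineTest (χ χ' : ℝ → ℝ) : Prop where
  hasDerivAt : ∀ x, HasDerivAt χ (χ' x) x
  continuous_deriv : Continuous χ'
  bounded_support : ∃ R : ℝ, ∀ x, R < |x| → χ x = 0

variable {χ χ' : ℝ → ℝ}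

theorem IsLineTest.continuous (h : IsLineTest χ χ') : Continuous χ :=
  continuous_iff_continuousAt.2 fun x => (h.hasDerivAt x).continuousAt

theorem IsLineTest.deriv_eq (h : IsLineTest χ χ') : deriv χ = χ' :=
  funext fun x => (h.hasDerivAt x).deriv

theorem IsLineTest.deriv_eq_zero (h : IsLineTest χ χ') {R : ℝ}
    (hR : ∀ x, R < |x| → χ x = 0) {x : ℝ} (hx : R < |x|) : χ' x = 0 := by
  have h1 : χ =ᶠ[nhds x] fun _ => 0 := by
    filter_upwards [(isOpen_Ioi.preimage continuous_abs).mem_nhds hx] with y hy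
    exact hR y hy
  have h2 := h1.deriv_eq
  rwa [h.deriv_eq, deriv_const] at h2

theorem IsLineTest.comp_neg (h : IsLineTest χ χ') :
    IsLineTest (fun x => χ (-x)) fun x => -χ' (-x) where
  hasDerivAt x := by
    have := (h.hasDerivAt (-x)).comp x (hasDerivAt_neg x)
    rwa [mul_neg_one] at this
  continuous_deriv := (h.continuous_deriv.comp continuous_neg).neg
  bounded_support := by
    obtain ⟨R, hR⟩ := h.bounded_support
    exact ⟨R, fun x hx => hR _ (by rwa [abs_neg])⟩

theorem integrable_of_continuous_of_bounded_support {f : ℝ → ℝ} (hf : Continuous f) {R : ℝ}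
    (hR : ∀ x, R < |x| → f x = 0) : Integrable f := by
  refine hf.integrable_of_hasCompactSupport (HasCompactSupport.intro (isCompact_Icc (a := -R) (b := R))
    fun x hx => hR x ?_)
  by_contra h
  exact hx (abs_le.1 (not_lt.1 h))

theorem IsLineTest.integrable (h : IsLineTest χ χ') : Integrable χ := by
  obtain ⟨R, hR⟩ := h.bounded_support
  exact integrable_of_continuous_of_bounded_support h.continuous hR

theorem IsLineTest.integrable_deriv (h : IsLineTest χ χ') : Integrable χ' := by
  obtain ⟨R, hR⟩ := h.bounded_support
  exact integrable_of_continuous_of_bounded_support h.continuous_deriv fun x =>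
    h.deriv_eq_zero hR

/-- Integration by parts on `(0, ∞)` for a function `u` which is merely the primitive of a square
integrable function. -/
theorem IsLineTest.integral_Ioi_by_parts (h : IsLineTest χ χ') {u v : ℝ → ℝ}
    (hv : MemLp v 2 (volume.restrict (Ici 0)))
    (huv : ∀ a ∈ Ici (0 : ℝ), ∀ b ∈ Ici (0 : ℝ), u b - u a = ∫ x in a..b, v x) :
    ∫ x in Ioi (0 : ℝ), (v x * χ x + u x * χ' x) = -(u 0 * χ 0) := by
  obtain ⟨R, hR⟩ := h.bounded_support
  set b := max R 0 + 1 with hb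
  have hb0 : 0 < b := by
    have := le_max_right R 0
    linarith
  have hbR : ∀ x, b ≤ x → R < |x| := fun x hx => by
    have h1 := le_max_left R 0
    have h2 := le_abs_self x
    linarith
  have hint := intervalIntegrable_of_memLp_Ici hv le_rfl hb0.le
  have e1 : ∫ x in Ioi (0 : ℝ), (v x * χ x + u x * χ' x) =
      ∫ x in (0 : ℝ)..b, (v x * χ x + u x * χ' x) := by
    rw [intervalIntegral.integral_of_le hb0.le]
    refine setIntegral_eq_of_subset_of_forall_sdiff_eq_zero measurableSet_Ioi
      Ioc_subset_Ioi_self fun x hx => ?_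
    have hx' : b ≤ x := by
      by_contra hc
      exact hx.2 ⟨hx.1, (not_le.1 hc).le⟩
    rw [hR x (hbR x hx'), h.deriv_eq_zero hR (hbR x hx')]
    simp
  have hac : AbsolutelyContinuousOnInterval (fun x => u 0 + ∫ t in (0 : ℝ)..x, v t) 0 b :=
    (contDiffOn_const (c := u 0)).absolutelyContinuousOnInterval.add
      (hint.absolutelyContinuousOnInterval_intervalIntegral left_mem_uIcc)
  have hac' : AbsolutelyContinuousOnInterval χ 0 b := by
    refine ContDiffOn.absolutelyContinuousOnInterval (ContDiff.contDiffOn ?_)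
    rw [contDiff_one_iff_deriv, h.deriv_eq]
    exact ⟨fun x => (h.hasDerivAt x).differentiableAt, h.continuous_deriv⟩
  have e2 := hac.integral_deriv_mul_eq_sub hac'
  rw [hR b (hbR b le_rfl), mul_zero, intervalIntegral.integral_same, add_zero, zero_sub] at e2
  rw [e1, ← e2]
  refine intervalIntegral.integral_congr_ae ?_
  filter_upwards [hint.ae_hasDerivAt_integral] with x hx hxb
  have h1 := ((hx (uIoc_subset_uIcc hxb) 0 left_mem_uIcc).const_add (u 0)).deriv
  rw [uIoc_of_le hb0.le] at hxb
  rw [h1, h.deriv_eq, ← huv 0 self_mem_Ici x hxb.1.le]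
  ring

theorem integral_eq_integral_Ioi_add {f : ℝ → ℝ} (hf : Integrable f) :
    ∫ x, f x = (∫ x in Ioi (0 : ℝ), f x) + ∫ x in Ioi (0 : ℝ), f (-x) := by
  rw [integral_comp_neg_Ioi, neg_zero, add_comm,
    intervalIntegral.integral_Iic_add_Ioi hf.integrableOn hf.integrableOn]

/-- The even extension `F` to the line of a multiple of a profile together with its derivative `G`:
`F` is continuous with `F 0 = a`, both decay exponentially, `G` is the weak derivative of `F` on
`ℝ` and on `(0, ∞)` (where a boundary term appears), and `- G' - κ g F = - 2 q δ₀` weakly. -/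
structure IsLineProfile (g : ℝ → ℝ) (κ ρ a q C₁ C₂ : ℝ) (F G : ℝ → ℝ) : Prop where
  continuous : Continuous F
  measurable : Measurable G
  apply_zero : F 0 = a
  bound : ∀ x, |F x| ≤ C₁ * Real.exp (-ρ * |x|)
  bound_deriv : ∀ x, |G x| ≤ C₂ * Real.exp (-ρ * |x|)
  weak_deriv : ∀ χ χ', IsLineTest χ χ' → ∫ x, (G x * χ x + F x * χ' x) = 0
  trace : ∀ χ χ', IsLineTest χ χ' → ∫ x in Ioi (0 : ℝ), (G x * χ x + F x * χ' x) = -(a * χ 0)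
  flux : ∀ χ χ', IsLineTest χ χ' → ∫ x, (-κ * (g x * F x) * χ x + G x * χ' x) = -(2 * q * χ 0)

theorem IsLineProfile.zero (g : ℝ → ℝ) (κ ρ : ℝ) :
    IsLineProfile g κ ρ 0 0 0 0 (fun _ => 0) fun _ => 0 where
  continuous := continuous_const
  measurable := measurable_const
  apply_zero := rfl
  bound x := by simp
  bound_deriv x := by simp
  weak_deriv χ χ' h := by simp
  trace χ χ' h := by simp
  flux χ χ' h := by simp

theorem IsLineProfile.const_mul {g : ℝ → ℝ} {κ ρ a q C₁ C₂ : ℝ} {F G : ℝ → ℝ}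
    (h : IsLineProfile g κ ρ a q C₁ C₂ F G) (s : ℝ) :
    IsLineProfile g κ ρ (s * a) (s * q) (|s| * C₁) (|s| * C₂) (fun x => s * F x)
      fun x => s * G x where
  continuous := h.continuous.const_mul s
  measurable := h.measurable.const_mul s
  apply_zero := by rw [h.apply_zero]
  bound x := by
    rw [abs_mul, mul_assoc]
    exact mul_le_mul_of_nonneg_left (h.bound x) (abs_nonneg s)
  bound_deriv x := by
    rw [abs_mul, mul_assoc]
    exact mul_le_mul_of_nonneg_left (h.bound_deriv x) (abs_nonneg s)
  weak_deriv χ χ' hχ := by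
    have e : ∀ x, s * G x * χ x + s * F x * χ' x = s * (G x * χ x + F x * χ' x) := fun x => by ring
    simp_rw [e]
    rw [integral_const_mul, h.weak_deriv χ χ' hχ, mul_zero]
  trace χ χ' hχ := by
    have e : ∀ x, s * G x * χ x + s * F x * χ' x = s * (G x * χ x + F x * χ' x) := fun x => by ring
    simp_rw [e]
    rw [integral_const_mul, h.trace χ χ' hχ]
    ring
  flux χ χ' hχ := by
    have e : ∀ x, -κ * (g x * (s * F x)) * χ x + s * G x * χ' x =
      s * (-κ * (g x * F x) * χ x + G x * χ' x) := fun x => by ring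
    simp_rw [e]
    rw [integral_const_mul, h.flux χ χ' hχ]
    ring

theorem integrable_mul_of_bound {f u : ℝ → ℝ} (hf : AEStronglyMeasurable f) {C : ℝ}
    (hC : ∀ᵐ x, |f x| ≤ C) (hu : Integrable u) : Integrable fun x => f x * u x :=
  hu.bdd_mul hf hC

/-- Even reflection of a profile. -/
theorem IsProfile.isLineProfile {g : ℝ → ℝ} {κ ρ M A : ℝ} {f f' f'' : ℝ → ℝ} (hρ : 0 < ρ)
    (hg : MemLp g ∞ volume) (hg_even : ∀ᵐ x : ℝ, g (-x) = g x)
    (h : IsProfile g κ ρ M A f f' f'') :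
    IsLineProfile g κ ρ 1 (f' 0) M A (fun x => f |x|) fun x => sgn x * f' |x| := by
  have hFc : Continuous fun x => f |x| :=
    h.hasH2Derivs.continuousOn.comp_continuous continuous_abs fun x => abs_nonneg x
  have hGm : Measurable fun x => sgn x * f' |x| :=
    measurable_sgn.mul (h.hasH2Derivs.continuousOn_fst.comp_continuous continuous_abs
      fun x => abs_nonneg x).measurable
  have hFb : ∀ x, |f (|x|)| ≤ M * Real.exp (-ρ * |x|) := fun x => h.bound _ (abs_nonneg x)
  have hGb : ∀ x, |sgn x * f' (|x|)| ≤ A * Real.exp (-ρ * |x|) := fun x => by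
    rw [abs_mul, abs_sgn, one_mul]
    exact h.bound_fst _ (abs_nonneg x)
  have hexp : ∀ {C : ℝ} {y : ℝ}, ∀ x, |y| ≤ C * Real.exp (-ρ * |x|) → |y| ≤ C := fun {C y} x hy => by
    have h1 : Real.exp (-ρ * |x|) ≤ 1 := by
      rw [Real.exp_le_one_iff]
      nlinarith [abs_nonneg x]
    have h2 : 0 < Real.exp (-ρ * |x|) := Real.exp_pos _
    have h3 : 0 ≤ C := nonneg_of_mul_nonneg_left ((abs_nonneg _).trans hy) h2
    nlinarith
  obtain ⟨N, hN0, hN⟩ := ae_abs_le_of_memLp_top hg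
  have iF : ∀ {u : ℝ → ℝ}, Integrable u → Integrable fun x => f |x| * u x := fun hu =>
    integrable_mul_of_bound hFc.aestronglyMeasurable
      (Eventually.of_forall fun x => hexp x (hFb x)) hu
  have iG : ∀ {u : ℝ → ℝ}, Integrable u → Integrable fun x => sgn x * f' |x| * u x := fun hu =>
    integrable_mul_of_bound hGm.aestronglyMeasurable
      (Eventually.of_forall fun x => hexp x (hGb x)) hu
  have iH : ∀ {u : ℝ → ℝ}, Integrable u → Integrable fun x => -κ * (g x * f |x|) * u x :=
    fun {u} hu => by
      have h1 : Integrable fun x => g x * (f |x| * u x) := integrable_mul_of_bound hg.1 hN (iF hu)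
      refine (h1.const_mul (-κ)).congr (Eventually.of_forall fun x => ?_)
      simp only
      ring
  have half : ∀ χ χ', IsLineTest χ χ' →
      ∫ x in Ioi (0 : ℝ), (sgn x * f' |x| * χ x + f |x| * χ' x) = -(1 * χ 0) := fun χ χ' hχ => by
    rw [← h.apply_zero, ← hχ.integral_Ioi_by_parts h.hasH2Derivs.memLp_fst
      h.hasH2Derivs.integral_fst]
    refine setIntegral_congr_fun measurableSet_Ioi fun x hx => ?_
    rw [sgn_of_pos hx, abs_of_pos hx, one_mul]
  have half' : ∀ χ χ', IsLineTest χ χ' →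
      ∫ x in Ioi (0 : ℝ), (-κ * (g x * f |x|) * χ x + sgn x * f' |x| * χ' x) =
        -(f' 0 * χ 0) := fun χ χ' hχ => by
    rw [← hχ.integral_Ioi_by_parts h.hasH2Derivs.memLp_snd h.hasH2Derivs.integral_snd]
    refine integral_congr_ae ?_
    filter_upwards [h.snd_eq, ae_restrict_mem measurableSet_Ioi] with x h1 hx
    rw [sgn_of_pos hx, abs_of_pos hx, one_mul, h1]
    ring
  refine ⟨hFc, hGm, by simp [h.apply_zero], hFb, hGb, fun χ χ' hχ => ?_, half, fun χ χ' hχ => ?_⟩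
  · rw [integral_eq_integral_Ioi_add (by exact (iG hχ.integrable).add (iF hχ.integrable_deriv)),
      half χ χ' hχ]
    have h1 := half _ _ hχ.comp_neg
    rw [neg_zero] at h1
    have h2 : ∫ x in Ioi (0 : ℝ), (sgn (-x) * f' |-x| * χ (-x) + f |-x| * χ' (-x)) = 1 * χ 0 := by
      rw [← neg_inj, ← h1, ← integral_neg]
      refine setIntegral_congr_fun measurableSet_Ioi fun x hx => ?_
      rw [abs_neg, sgn_of_pos hx, sgn_neg_of_pos hx]
      ring
    rw [h2]
    ring
  · rw [integral_eq_integral_Ioi_add (by exact (iH hχ.integrable).add (iG hχ.integrable_deriv)),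
      half' χ χ' hχ]
    have h1 := half' _ _ hχ.comp_neg
    rw [neg_zero] at h1
    have h2 : ∫ x in Ioi (0 : ℝ), (-κ * (g (-x) * f |-x|) * χ (-x) +
        sgn (-x) * f' |-x| * χ' (-x)) = -(f' 0 * χ 0) := by
      rw [← h1]
      refine integral_congr_ae ?_
      filter_upwards [ae_restrict_of_ae hg_even, ae_restrict_mem measurableSet_Ioi] with x h3 hx
      rw [abs_neg, sgn_of_pos hx, sgn_neg_of_pos hx, h3]
      ring
    rw [h2]
    ring

end Line

/-! ### Modes and their superposition on the strip -/

section Strip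

variable {T : ℝ} {ψ : ℝ × ℝ → ℝ}

theorem IsTestFunction.differentiable (h : IsTestFunction T ψ) : Differentiable ℝ ψ :=
  h.smooth.differentiable (by simp)

theorem IsTestFunction.continuous_dx (h : IsTestFunction T ψ) : Continuous (dx ψ) :=
  (h.smooth.continuous_fderiv (by simp)).clm_apply continuous_const

theorem IsTestFunction.continuous_dt (h : IsTestFunction T ψ) : Continuous (dt ψ) :=
  (h.smooth.continuous_fderiv (by simp)).clm_apply continuous_const

theorem IsTestFunction.hasDerivAt_dx (h : IsTestFunction T ψ) (x t : ℝ) :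
    HasDerivAt (fun x => ψ (x, t)) (dx ψ (x, t)) x :=
  (h.differentiable (x, t)).hasFDerivAt.comp_hasDerivAt x
    ((hasDerivAt_id x).prodMk (hasDerivAt_const x t))

theorem IsTestFunction.hasDerivAt_dt (h : IsTestFunction T ψ) (x t : ℝ) :
    HasDerivAt (fun t => ψ (x, t)) (dt ψ (x, t)) t :=
  (h.differentiable (x, t)).hasFDerivAt.comp_hasDerivAt t
    ((hasDerivAt_const t x).prodMk (hasDerivAt_id t))

theorem IsTestFunction.isLineTest (h : IsTestFunction T ψ) (t : ℝ) :
    IsLineTest (fun x => ψ (x, t)) fun x => dx ψ (x, t) where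
  hasDerivAt x := h.hasDerivAt_dx x t
  continuous_deriv := h.continuous_dx.comp (by fun_prop)
  bounded_support := by
    obtain ⟨R, hR⟩ := h.compact
    exact ⟨R, fun x hx => hR x t hx⟩

theorem IsTestFunction.exists_bounded_support (h : IsTestFunction T ψ) :
    ∃ R : ℝ, ∀ p : ℝ × ℝ, R < |p.1| → ψ p = 0 ∧ dx ψ p = 0 ∧ dt ψ p = 0 := by
  obtain ⟨R, hR⟩ := h.compact
  refine ⟨R, fun p hp => ⟨hR p.1 p.2 hp, ?_, ?_⟩⟩
  · exact (h.isLineTest p.2).deriv_eq_zero (R := R) (fun x hx => hR x p.2 hx) hp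
  · have h1 := (h.hasDerivAt_dt p.1 p.2).deriv
    have h2 : (fun t => ψ (p.1, t)) = fun _ => 0 := funext fun t => hR p.1 t hp
    rw [h2, deriv_const] at h1
    exact h1.symm

theorem restrict_strip (s : Set ℝ) (T : ℝ) :
    (volume : Measure (ℝ × ℝ)).restrict (s ×ˢ Ioc 0 T) =
      (volume.restrict s).prod (volume.restrict (Ioc 0 T)) := by
  rw [Measure.volume_eq_prod, Measure.prod_restrict]

theorem restrict_strip_univ (T : ℝ) :
    (volume : Measure (ℝ × ℝ)).restrict (strip T) =
      (volume : Measure ℝ).prod (volume.restrict (Ioc 0 T)) := by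
  rw [strip, restrict_strip, Measure.restrict_univ]

theorem memLp_strip_of_continuous {f : ℝ × ℝ → ℝ} (hf : Continuous f) {R : ℝ}
    (hR : ∀ p : ℝ × ℝ, R < |p.1| → f p = 0) : MemLp f 2 (volume.restrict (strip T)) := by
  obtain ⟨C, hC⟩ := (isCompact_Icc (a := -R) (b := R)).prod (isCompact_Icc (a := (0 : ℝ)) (b := T))
    |>.exists_bound_of_continuousOn hf.continuousOn
  have h1 : MemLp ((Icc (-R) R ×ˢ Icc 0 T).indicator fun _ : ℝ × ℝ => C) 2
      (volume.restrict (strip T)) := by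
    refine memLp_indicator_const 2 (measurableSet_Icc.prod measurableSet_Icc) C (Or.inr ?_)
    refine ((Measure.restrict_apply_le _ _).trans_lt ?_).ne
    exact ((isCompact_Icc (a := -R) (b := R)).prod
      (isCompact_Icc (a := (0 : ℝ)) (b := T))).measure_lt_top
  refine h1.mono' hf.aestronglyMeasurable ?_
  filter_upwards [ae_restrict_mem (MeasurableSet.univ.prod measurableSet_Ioc)] with p hp
  by_cases h : p ∈ Icc (-R) R ×ˢ Icc 0 T
  · rw [indicator_of_mem h]
    exact hC p h
  · rw [indicator_of_notMem h, hR p, norm_zero]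
    by_contra hc
    exact h ⟨abs_le.1 (not_lt.1 hc), hp.2.1.le, hp.2.2⟩

theorem IsTestFunction.memLp (h : IsTestFunction T ψ) :
    MemLp ψ 2 (volume.restrict (strip T)) := by
  obtain ⟨R, hR⟩ := h.exists_bounded_support
  exact memLp_strip_of_continuous h.smooth.continuous fun p hp => (hR p hp).1

theorem IsTestFunction.memLp_dx (h : IsTestFunction T ψ) :
    MemLp (dx ψ) 2 (volume.restrict (strip T)) := by
  obtain ⟨R, hR⟩ := h.exists_bounded_support
  exact memLp_strip_of_continuous h.continuous_dx fun p hp => (hR p hp).2.1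

theorem IsTestFunction.memLp_dt (h : IsTestFunction T ψ) :
    MemLp (dt ψ) 2 (volume.restrict (strip T)) := by
  obtain ⟨R, hR⟩ := h.exists_bounded_support
  exact memLp_strip_of_continuous h.continuous_dt fun p hp => (hR p hp).2.2

theorem memLp_prod_mul {H c : ℝ → ℝ} (hH : MemLp H 2 volume)
    (hc : MemLp c 2 (volume.restrict (Ioc 0 T))) :
    MemLp (fun p : ℝ × ℝ => H p.1 * c p.2) 2 (volume.restrict (strip T)) := by
  rw [restrict_strip_univ]
  have hm : AEStronglyMeasurable (fun p : ℝ × ℝ => H p.1 * c p.2)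
    ((volume : Measure ℝ).prod (volume.restrict (Ioc 0 T))) := hH.1.comp_fst.mul hc.1.comp_snd
  rw [memLp_two_iff_integrable_sq hm]
  refine (hH.integrable_sq.mul_prod hc.integrable_sq).congr (Eventually.of_forall fun p => ?_)
  simp only
  ring

theorem memLp_Ioc_of_continuous {c : ℝ → ℝ} (hc : Continuous c) (p : ℝ≥0∞) :
    MemLp c p (volume.restrict (Ioc 0 T)) := by
  obtain ⟨C, hC⟩ := (isCompact_Icc (a := (0 : ℝ)) (b := T)).exists_bound_of_continuousOn
    hc.continuousOn
  refine MemLp.of_bound hc.aestronglyMeasurable C ?_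
  filter_upwards [ae_restrict_mem measurableSet_Ioc] with t ht
  exact hC t ⟨ht.1.le, ht.2⟩

/-- Integration by parts over a period. -/
theorem integral_Ioc_mul_deriv (hT : 0 ≤ T) {c c' η η' : ℝ → ℝ}
    (hc : ∀ t, HasDerivAt c (c' t) t) (hc' : Continuous c') (hcT : c T = c 0)
    (hη : ∀ t, HasDerivAt η (η' t) t) (hη' : Continuous η') (hηT : η T = η 0) :
    ∫ t in Ioc 0 T, c t * η' t = -∫ t in Ioc 0 T, c' t * η t := by
  rw [← intervalIntegral.integral_of_le hT, ← intervalIntegral.integral_of_le hT,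
    intervalIntegral.integral_mul_deriv_eq_deriv_mul (fun t _ => hc t) (fun t _ => hη t)
      (hc'.intervalIntegrable _ _) (hη'.intervalIntegrable _ _), hcT, hηT]
  ring

/-- Integration by parts in `t` for a product `H(x) c(t)`, which only needs `H` to be square
integrable. -/
theorem integral_strip_mul_dt (hT : 0 ≤ T) (h : IsTestFunction T ψ) {H c c' : ℝ → ℝ}
    (hH : MemLp H 2 volume) (hc : ∀ t, HasDerivAt c (c' t) t) (hc' : Continuous c')
    (hcT : c T = c 0) :
    ∫ p in strip T, H p.1 * c p.2 * dt ψ p = -∫ p in strip T, H p.1 * c' p.2 * ψ p := by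
  have hcc : Continuous c := continuous_iff_continuousAt.2 fun t => (hc t).continuousAt
  have i1 := (memLp_prod_mul hH (memLp_Ioc_of_continuous (T := T) hcc 2)).integrable_mul h.memLp_dt
  have i2 := (memLp_prod_mul hH (memLp_Ioc_of_continuous (T := T) hc' 2)).integrable_mul h.memLp
  rw [restrict_strip_univ] at i1 i2 ⊢
  have e1 := integral_prod _ i1
  have e2 := integral_prod _ i2
  simp only [Pi.mul_apply] at e1 e2
  rw [e1, e2, ← integral_neg]
  refine integral_congr_ae (Eventually.of_forall fun x => ?_)
  simp only [mul_assoc]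
  rw [integral_const_mul, integral_const_mul, integral_Ioc_mul_deriv hT hc hc' hcT
    (fun t => h.hasDerivAt_dt x t) (h.continuous_dt.comp (by fun_prop))
    (by simpa using h.periodic x 0)]
  ring

/-- By Fubini, a weak identity on `s ⊆ ℝ` tested with functions of `x` passes to the product with
any continuous function `c` of `t`. -/
theorem integral_strip_mul_dx {s : Set ℝ} (h : IsTestFunction T ψ)
    {H₁ H₂ c : ℝ → ℝ} {K : ℝ} (hH₁ : MemLp H₁ 2 volume) (hH₂ : MemLp H₂ 2 volume)
    (hc : Continuous c)
    (hK : ∀ χ χ', IsLineTest χ χ' → ∫ x in s, (H₁ x * χ x + H₂ x * χ' x) = -(K * χ 0)) :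
    ∫ p in s ×ˢ Ioc 0 T, (H₁ p.1 * c p.2 * ψ p + H₂ p.1 * c p.2 * dx ψ p) =
      -(K * ∫ t in Ioc 0 T, c t * ψ (0, t)) := by
  have hc2 := memLp_Ioc_of_continuous (T := T) hc 2
  have hsub : s ×ˢ Ioc 0 T ⊆ strip T := prod_mono (subset_univ _) le_rfl
  have i0 := ((memLp_prod_mul hH₁ hc2).integrable_mul h.memLp).add
    ((memLp_prod_mul hH₂ hc2).integrable_mul h.memLp_dx)
  have i1 := i0.mono_measure (Measure.restrict_mono hsub le_rfl)
  rw [restrict_strip] at i1 ⊢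
  have e1 := integral_prod_symm _ i1
  simp only [Pi.mul_apply, Pi.add_apply] at e1
  rw [e1, ← integral_const_mul, ← integral_neg]
  refine integral_congr_ae (Eventually.of_forall fun t => ?_)
  simp only
  have e2 : ∀ x, H₁ x * c t * ψ (x, t) + H₂ x * c t * dx ψ (x, t) =
    c t * (H₁ x * ψ (x, t) + H₂ x * dx ψ (x, t)) := fun x => by ring
  simp_rw [e2]
  rw [integral_const_mul, hK _ _ (h.isLineTest t)]
  ring

end Strip

section Modes

variable {g : ℝ → ℝ} {κ ρ a q C₁ C₂ : ℝ} {F G : ℝ → ℝ}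

theorem memLp_of_exp_bound (hρ : 0 < ρ) {f : ℝ → ℝ} (hf : AEStronglyMeasurable f) {C : ℝ}
    (hC : ∀ x, |f x| ≤ C * Real.exp (-ρ * |x|)) : MemLp f 2 volume :=
  ((memLp_exp_neg_mul_abs hρ).const_mul C).mono' hf (Eventually.of_forall hC)

theorem IsLineProfile.memLp (h : IsLineProfile g κ ρ a q C₁ C₂ F G) (hρ : 0 < ρ) :
    MemLp F 2 volume :=
  memLp_of_exp_bound hρ h.continuous.aestronglyMeasurable h.bound

theorem IsLineProfile.memLp_deriv (h : IsLineProfile g κ ρ a q C₁ C₂ F G) (hρ : 0 < ρ) :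
    MemLp G 2 volume :=
  memLp_of_exp_bound hρ h.measurable.aestronglyMeasurable h.bound_deriv

variable {T : ℝ} {ψ : ℝ × ℝ → ℝ} {b b' : ℝ → ℝ}

/-- The weak form of the equation for a single mode `F(x) b(t)` with `b'' = - κ b`. -/
theorem IsLineProfile.weak_form (h : IsLineProfile g κ ρ a q C₁ C₂ F G) (hρ : 0 < ρ)
    (hg : MemLp g ∞ volume) (hT : 0 ≤ T) (hψ : IsTestFunction T ψ)
    (hb : Continuous b) (hb' : ∀ t, HasDerivAt b' (-κ * b t) t) (hbT : b' T = b' 0) :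
    (∫ p in strip T, F p.1 * b' p.2 * (-(g p.1) * dt ψ p)) +
      ∫ p in strip T, G p.1 * b p.2 * dx ψ p =
      -(2 * q * ∫ t in Ioc 0 T, b t * ψ (0, t)) := by
  have hgF : MemLp (fun x => g x * F x) 2 volume := MemLp.mul' (h.memLp hρ) hg
  have hb2 := memLp_Ioc_of_continuous (T := T) hb 2
  have e1 := integral_strip_mul_dt hT hψ hgF hb' (hb.const_mul (-κ)) hbT
  have e2 : ∫ p in strip T, F p.1 * b' p.2 * (-(g p.1) * dt ψ p) =
      ∫ p in strip T, -κ * (g p.1 * F p.1) * b p.2 * ψ p := by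
    have : ∫ p in strip T, F p.1 * b' p.2 * (-(g p.1) * dt ψ p) =
        -∫ p in strip T, g p.1 * F p.1 * b' p.2 * dt ψ p := by
      rw [← integral_neg]
      refine integral_congr_ae (Eventually.of_forall fun p => ?_)
      simp only
      ring
    rw [this, e1, neg_neg]
    refine integral_congr_ae (Eventually.of_forall fun p => ?_)
    simp only
    ring
  have e3 := integral_strip_mul_dx (s := univ) hψ (hgF.const_mul (-κ)) (h.memLp_deriv hρ) hb
    (K := 2 * q) (fun χ χ' hχ => by simpa only [Measure.restrict_univ] using h.flux χ χ' hχ)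
  rw [e2, ← e3]
  exact (integral_add ((memLp_prod_mul (hgF.const_mul (-κ)) hb2).integrable_mul hψ.memLp)
    ((memLp_prod_mul (h.memLp_deriv hρ) hb2).integrable_mul hψ.memLp_dx)).symm

theorem IsLineProfile.strip_weak_x (h : IsLineProfile g κ ρ a q C₁ C₂ F G) (hρ : 0 < ρ)
    (hψ : IsTestFunction T ψ) (hb : Continuous b) :
    ∫ p in strip T, F p.1 * b p.2 * dx ψ p = -∫ p in strip T, G p.1 * b p.2 * ψ p := by
  have hb2 := memLp_Ioc_of_continuous (T := T) hb 2
  have e2 : ∀ χ χ', IsLineTest χ χ' → ∫ x in univ, (G x * χ x + F x * χ' x) = -(0 * χ 0) := by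
    intro χ χ' hχ
    rw [Measure.restrict_univ, h.weak_deriv χ χ' hχ, zero_mul, neg_zero]
  have e3 := integral_strip_mul_dx hψ (h.memLp_deriv hρ) (h.memLp hρ) hb e2
  have e4 := integral_add ((memLp_prod_mul (h.memLp_deriv hρ) hb2).integrable_mul hψ.memLp)
    ((memLp_prod_mul (h.memLp hρ) hb2).integrable_mul hψ.memLp_dx)
  simp only [Pi.mul_apply] at e4
  rw [strip] at e4 ⊢
  rw [e3] at e4
  linarith

theorem IsLineProfile.strip_trace (h : IsLineProfile g κ ρ a q C₁ C₂ F G) (hρ : 0 < ρ)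
    (hψ : IsTestFunction T ψ) (hb : Continuous b) :
    (∫ p in Ioi (0 : ℝ) ×ˢ Ioc 0 T, G p.1 * b p.2 * ψ p) +
      ∫ p in Ioi (0 : ℝ) ×ˢ Ioc 0 T, F p.1 * b p.2 * dx ψ p =
      -(a * ∫ t in Ioc 0 T, b t * ψ (0, t)) := by
  have hb2 := memLp_Ioc_of_continuous (T := T) hb 2
  rw [← integral_strip_mul_dx (s := Ioi 0) hψ (h.memLp_deriv hρ) (h.memLp hρ) hb h.trace]
  have hsub : Ioi (0 : ℝ) ×ˢ Ioc 0 T ⊆ strip T := prod_mono (subset_univ _) le_rfl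
  have hm := Measure.restrict_mono hsub (le_refl (volume : Measure (ℝ × ℝ)))
  exact (integral_add
    (((memLp_prod_mul (h.memLp_deriv hρ) hb2).integrable_mul hψ.memLp).mono_measure hm)
    (((memLp_prod_mul (h.memLp hρ) hb2).integrable_mul hψ.memLp_dx).mono_measure hm)).symm

end Modes

section Superposition

variable {Ω : Type*} [MeasurableSpace Ω] {μ : Measure Ω} {ι : Type*}

theorem summable_of_pairwise_orthogonal {H : Type*} [NormedAddCommGroup H] [InnerProductSpace ℝ H]
    [CompleteSpace H] (u : ι → H) (horth : Pairwise fun i j => inner ℝ (u i) (u j) = 0)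
    (hu : Summable fun i => ‖u i‖ ^ 2) : Summable u := by
  classical
  have hV : OrthogonalFamily ℝ (fun i => Submodule.span ℝ {u i})
      fun i => (Submodule.span ℝ {u i}).subtypeₗᵢ :=
    OrthogonalFamily.of_pairwise fun i j hij => by
      refine Submodule.isOrtho_span.2 ?_
      rintro _ rfl _ rfl
      exact horth hij
  exact (hV.summable_iff_norm_sq_summable
    fun i => ⟨u i, Submodule.mem_span_singleton_self _⟩).2 hu

/-- A pairwise orthogonal series of square integrable functions with summable squared norms
converges weakly in `L²`. -/
theorem exists_memLp_forall_hasSum_integral_mul (f : ι → Ω → ℝ) (hf : ∀ i, MemLp (f i) 2 μ)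
    (horth : Pairwise fun i j => ∫ x, f i x * f j x ∂μ = 0)
    (hsum : Summable fun i => ∫ x, f i x * f i x ∂μ) :
    ∃ W : Ω → ℝ, MemLp W 2 μ ∧ ∀ φ : Ω → ℝ, MemLp φ 2 μ →
      HasSum (fun i => ∫ x, f i x * φ x ∂μ) (∫ x, W x * φ x ∂μ) := by
  have h : Summable fun i => (hf i).toLp (f i) :=
    summable_of_pairwise_orthogonal _ (fun i j hij => by
      exact (inner_toLp_toLp (hf i) (hf j)).trans (horth hij)) (hsum.congr fun i => by
      rw [← real_inner_self_eq_norm_sq, inner_toLp_toLp])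
  refine ⟨_, Lp.memLp (∑' i, (hf i).toLp (f i)), fun φ hφ => ?_⟩
  have h1 := h.hasSum.mapL (innerSL ℝ (hφ.toLp φ))
  simp only [innerSL_apply_apply, inner_toLp_toLp] at h1
  rw [inner_toLp_left] at h1
  simpa only [mul_comm] using h1

/-- Termwise integration of a series of functions with `|f i| ≤ c i * B`. -/
theorem hasSum_integral_tsum_mul [Countable ι] {f : ι → Ω → ℝ} {c : ι → ℝ} {B φ : Ω → ℝ}
    (hf : ∀ i, AEStronglyMeasurable (f i) μ) (hc : Summable c)
    (hle : ∀ i x, |f i x| ≤ c i * B x) (hB : MemLp B 2 μ) (hφ : MemLp φ 2 μ) :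
    HasSum (fun i => ∫ x, f i x * φ x ∂μ) (∫ x, (∑' i, f i x) * φ x ∂μ) := by
  have hBφ : Integrable (fun x => B x * |φ x|) μ := hB.integrable_mul hφ.norm
  refine hasSum_integral_of_dominated_convergence (fun i x => c i * (B x * |φ x|))
    (fun i => (hf i).mul hφ.1) (fun i => Eventually.of_forall fun x => ?_)
    (Eventually.of_forall fun x => hc.mul_right _) ?_ (Eventually.of_forall fun x => ?_)
  · rw [norm_mul, Real.norm_eq_abs, Real.norm_eq_abs, ← mul_assoc]
    exact mul_le_mul_of_nonneg_right (hle i x) (abs_nonneg _)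
  · simp only [tsum_mul_right]
    exact hBφ.const_mul _
  · have : Summable fun i => f i x :=
      Summable.of_norm_bounded (hc.mul_right (B x)) fun i => hle i x
    exact this.hasSum.mul_right _

end Superposition

/-! ### Periodic functions and the wave series -/

section CasLine

variable {T : ℝ}

variable (T) in
/-- The function `cas n` of the circle as a `T`-periodic function on `ℝ`. -/
noncomputable def casLine (n : ℤ) (t : ℝ) : ℝ := cas n (t : AddCircle T)

theorem casLine_add_period (n : ℤ) (t : ℝ) : casLine T n (t + T) = casLine T n t := by
  rw [casLine, AddCircle.coe_add_period, casLine]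

theorem casLine_period (n : ℤ) : casLine T n T = casLine T n 0 := by
  simpa using casLine_add_period (T := T) n 0

theorem continuous_casLine (n : ℤ) : Continuous (casLine T n) :=
  (cas n).continuous.comp (AddCircle.continuous_mk' T)

theorem hasDerivAt_casLine (n : ℤ) (t : ℝ) :
    HasDerivAt (casLine T n) (2 * Real.pi / T * n * casLine T (-n) t) t := by
  have h := hasDerivAt_fourier T n t
  have hre := Complex.reCLM.hasFDerivAt.comp_hasDerivAt t h
  have him := Complex.imCLM.hasFDerivAt.comp_hasDerivAt t h
  refine (hre.add him).congr_deriv ?_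
  have e : (2 * Real.pi * Complex.I * n / T * fourier n (t : AddCircle T) : ℂ) =
      ((2 * Real.pi / T * n : ℝ) : ℂ) * (Complex.I * fourier n (t : AddCircle T)) := by
    push_cast
    ring
  rw [e, casLine, cas_apply, fourier_neg]
  simp only [Complex.reCLM_apply, Complex.imCLM_apply, Complex.re_ofReal_mul,
    Complex.im_ofReal_mul, Complex.I_mul_re, Complex.I_mul_im, Complex.conj_re, Complex.conj_im]
  ring

theorem contDiff_casLine (n : ℤ) : ContDiff ℝ (⊤ : ℕ∞) (casLine T n) := by
  rw [contDiff_infty]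
  intro m
  induction m generalizing n with
  | zero => exact contDiff_zero.2 (continuous_casLine n)
  | succ m ih =>
    rw [show ((m + 1 : ℕ) : WithTop ℕ∞) = (m : WithTop ℕ∞) + 1 by push_cast; rfl,
      contDiff_succ_iff_deriv]
    refine ⟨fun t => (hasDerivAt_casLine n t).differentiableAt, by simp, ?_⟩
    rw [show deriv (casLine T n) = fun t => 2 * Real.pi / T * n * casLine T (-n) t from
      funext fun t => (hasDerivAt_casLine n t).deriv]
    exact contDiff_const.mul (ih (-n))

theorem abs_casLine_le (n : ℤ) (t : ℝ) : |casLine T n t| ≤ 2 := by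
  have h : ‖fourier n (t : AddCircle T)‖ = 1 := Circle.norm_coe _
  have h1 := Complex.abs_re_le_norm (fourier n (t : AddCircle T))
  have h2 := Complex.abs_im_le_norm (fourier n (t : AddCircle T))
  rw [casLine, cas_apply]
  refine (abs_add_le _ _).trans ?_
  linarith

theorem exists_continuousMap_of_periodic {η : ℝ → ℝ} (hη : Continuous η)
    (hper : ∀ t, η (t + T) = η t) : ∃ H : C(AddCircle T, ℝ), ∀ t : ℝ, H t = η t :=
  have h : Function.Periodic η T := hper
  ⟨⟨h.lift, hη.quotient_liftOn' _⟩, fun t => h.lift_coe t⟩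

variable [hT : Fact (0 < T)]

theorem integral_Ioc_coe (f : AddCircle T → ℝ) :
    ∫ t in Ioc 0 T, f (t : AddCircle T) = T * ∫ x, f x ∂haarAddCircle := by
  have h := AddCircle.integral_preimage T 0 f
  rw [zero_add] at h
  rw [h, integral_haarAddCircle, smul_eq_mul, mul_inv_cancel_left₀ hT.out.ne']

theorem memLp_coe {f : AddCircle T → ℝ} {p : ℝ≥0∞} (hf : MemLp f p haarAddCircle) :
    MemLp (fun t : ℝ => f (t : AddCircle T)) p (volume.restrict (Ioc 0 T)) := by
  have h := AddCircle.measurePreserving_mk T 0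
  rw [zero_add] at h
  refine MemLp.comp_measurePreserving ?_ h
  rw [volume_eq_smul_haarAddCircle]
  exact hf.smul_measure (by finiteness)

theorem integral_casLine_mul_casLine (n m : ℤ) :
    ∫ t in Ioc 0 T, casLine T n t * casLine T m t = if n = m then T else 0 := by
  have := integral_Ioc_coe (T := T) fun x => cas n x * cas m x
  rw [integral_cas_mul_cas] at this
  simpa [casLine] using this

theorem integral_casLine_mul {H : AddCircle T → ℝ} (n : ℤ) :
    ∫ t in Ioc 0 T, casLine T n t * H t = T * casCoeff H n :=
  integral_Ioc_coe fun x => cas n x * H x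

/-- The Euler-Lagrange equation in an arbitrary direction `H`: both sides only see the antiperiodic
part of `H`. -/
theorem integral_cube_mul_eq {c : ℤ → ℝ} (hc : ∀ n, Even n → c n = 0) {z : AddCircle T → ℝ}
    (hz : MemLp z 4 haarAddCircle)
    (hanti : ∀ᵐ x ∂haarAddCircle, z (x + halfPeriod T) = -z x)
    (hEL : ∀ h : AddCircle T → ℝ, MemLp h 4 haarAddCircle →
      (∀ᵐ x ∂haarAddCircle, h (x + halfPeriod T) = -h x) →
      (∫ x, z x ^ 3 * h x ∂haarAddCircle) + 2 * ∑' n, c n * (casCoeff z n * casCoeff h n) = 0)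
    {H : AddCircle T → ℝ} (hH : MemLp H 4 haarAddCircle) :
    ∫ x, z x ^ 3 * H x ∂haarAddCircle = -(2 * ∑' n, c n * (casCoeff z n * casCoeff H n)) := by
  have hmp := measurePreserving_add_right (haarAddCircle (T := T)) (halfPeriod T)
  have hHτ : MemLp (fun x => H (x + halfPeriod T)) 4 haarAddCircle := hH.comp_measurePreserving hmp
  have hh : MemLp (fun x => 2⁻¹ * (H x - H (x + halfPeriod T))) 4 haarAddCircle :=
    (hH.sub hHτ).const_mul 2⁻¹
  have h1 := hEL _ hh (Eventually.of_forall fun x => by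
    rw [add_assoc, halfPeriod_add_halfPeriod, add_zero]
    ring)
  have i1 := integrable_pow_mul_pow hz hH (i := 3) (j := 1) rfl
  have i2 := integrable_pow_mul_pow hz hHτ (i := 3) (j := 1) rfl
  simp only [pow_one] at i1 i2
  have e1 : ∫ x, z x ^ 3 * H (x + halfPeriod T) ∂haarAddCircle =
      -∫ x, z x ^ 3 * H x ∂haarAddCircle := by
    rw [← integral_comp_add_halfPeriod, ← integral_neg]
    refine integral_congr_ae ?_
    filter_upwards [hanti] with x hx
    rw [hx, add_assoc, halfPeriod_add_halfPeriod, add_zero]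
    ring
  have e2 : ∫ x, z x ^ 3 * (2⁻¹ * (H x - H (x + halfPeriod T))) ∂haarAddCircle =
      ∫ x, z x ^ 3 * H x ∂haarAddCircle := by
    have : ∀ x, z x ^ 3 * (2⁻¹ * (H x - H (x + halfPeriod T))) =
      2⁻¹ * (z x ^ 3 * H x - z x ^ 3 * H (x + halfPeriod T)) := fun x => by ring
    simp_rw [this]
    rw [integral_const_mul, integral_sub i1 i2, e1]
    ring
  have e3 : ∀ n, c n * (casCoeff z n * casCoeff (fun x => 2⁻¹ * (H x - H (x + halfPeriod T))) n) =
      c n * (casCoeff z n * casCoeff H n) := fun n => by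
    rcases Int.even_or_odd n with hn | hn
    · rw [hc n hn, zero_mul, zero_mul]
    · have j1 := (memLp_continuousMap (T := T) (cas n) 2).integrable_mul
        (memLp_two_of_memLp_four hH)
      have j2 := (memLp_continuousMap (T := T) (cas n) 2).integrable_mul
        (memLp_two_of_memLp_four hHτ)
      have e5 := integral_sub j1 j2
      simp only [Pi.mul_apply] at e5
      have e4 : casCoeff (fun x => 2⁻¹ * (H x - H (x + halfPeriod T))) n =
          2⁻¹ * (casCoeff H n - casCoeff (fun x => H (x + halfPeriod T)) n) := by
        rw [casCoeff, casCoeff, casCoeff, ← e5, ← integral_const_mul]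
        refine integral_congr_ae (Eventually.of_forall fun x => ?_)
        simp only
        ring
      rw [e4, casCoeff_comp_add_halfPeriod_of_odd hn]
      ring
  rw [e2, tsum_congr e3] at h1
  linarith

end CasLine

section Assembly

theorem summable_abs_of_summable_mul_sq {a : ℤ → ℝ} (h0 : a 0 = 0)
    (ha : Summable fun n : ℤ => ((n : ℝ) * a n) ^ 2) : Summable fun n => |a n| := by
  have h1 : Summable fun n : ℤ => 1 / (n : ℝ) ^ 2 := Real.summable_one_div_int_pow.2 one_lt_two
  refine Summable.of_nonneg_of_le (fun n => abs_nonneg _) (fun n => ?_) (ha.add h1)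
  rcases eq_or_ne n 0 with rfl | hn
  · simp [h0]
  · have hn' : (n : ℝ) ≠ 0 := by exact_mod_cast hn
    have e : |a n| = |(n : ℝ) * a n| * |1 / (n : ℝ)| := by
      rw [← abs_mul]
      congr 1
      field_simp
    rw [e, ← sq_abs ((n : ℝ) * a n), show 1 / (n : ℝ) ^ 2 = |1 / (n : ℝ)| ^ 2 by
      rw [sq_abs, div_pow, one_pow]]
    nlinarith [sq_nonneg (|(n : ℝ) * a n| - |1 / (n : ℝ)|), sq_nonneg (|(n : ℝ) * a n|),
      sq_nonneg (|1 / (n : ℝ)|)]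

variable {T : ℝ}

theorem integral_strip_prod_mul (H c : ℝ → ℝ) :
    ∫ p in strip T, H p.1 * c p.2 = (∫ x, H x) * ∫ t in Ioc 0 T, c t := by
  rw [restrict_strip_univ, integral_prod_mul]

theorem integral_strip_mul_indicator {S : Set (ℝ × ℝ)} (hS : MeasurableSet S) (hsub : S ⊆ strip T)
    (f φ : ℝ × ℝ → ℝ) : ∫ p in strip T, f p * S.indicator φ p = ∫ p in S, f p * φ p := by
  have : (fun p => f p * S.indicator φ p) = S.indicator fun p => f p * φ p := by
    funext p
    by_cases hp : p ∈ S <;> simp [hp]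
  rw [this, setIntegral_indicator hS, inter_eq_self_of_subset_right hsub]

variable [hT : Fact (0 < T)] {ρ : ℝ}

/-- Superposition of modes `H n x * cas (σ n) t` which are orthogonal in `L²` of the strip. -/
theorem exists_superposition (hρ : 0 < ρ) {H : ℤ → ℝ → ℝ} {σ : ℤ → ℤ}
    (hσ : Function.Injective σ) {D : ℤ → ℝ} (hH : ∀ n, AEStronglyMeasurable (H n))
    (hD : ∀ n x, |H n x| ≤ D n * Real.exp (-ρ * |x|)) (hsum : Summable fun n => D n ^ 2) :
    ∃ W : ℝ × ℝ → ℝ, MemLp W 2 (volume.restrict (strip T)) ∧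
      ∀ φ : ℝ × ℝ → ℝ, MemLp φ 2 (volume.restrict (strip T)) →
        HasSum (fun n => ∫ p in strip T, H n p.1 * casLine T (σ n) p.2 * φ p)
          (∫ p in strip T, W p * φ p) := by
  have hH2 : ∀ n, MemLp (H n) 2 volume := fun n => memLp_of_exp_bound hρ (hH n) (hD n)
  have hprod : ∀ n m, ∫ p in strip T, H n p.1 * casLine T (σ n) p.2 *
      (H m p.1 * casLine T (σ m) p.2) = (∫ x, H n x * H m x) * if σ n = σ m then T else 0 :=
    fun n m => by
      rw [← integral_casLine_mul_casLine, ← integral_strip_prod_mul]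
      refine integral_congr_ae (Eventually.of_forall fun p => ?_)
      simp only
      ring
  refine exists_memLp_forall_hasSum_integral_mul _ (fun n => memLp_prod_mul (hH2 n)
    (memLp_Ioc_of_continuous (continuous_casLine _) 2)) (fun n m hnm => ?_) ?_
  · refine (hprod n m).trans ?_
    rw [if_neg fun h => hnm (hσ h), mul_zero]
  · have hE := (memLp_exp_neg_mul_abs hρ).integrable_sq
    refine Summable.of_nonneg_of_le (fun n => ?_) (fun n => ?_)
      (hsum.mul_right ((∫ x : ℝ, Real.exp (-ρ * |x|) ^ 2) * T))
    · exact integral_nonneg fun p => mul_self_nonneg _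
    · rw [hprod, if_pos rfl, ← mul_assoc, ← integral_const_mul]
      refine mul_le_mul_of_nonneg_right ?_ hT.out.le
      refine integral_mono ((hH2 n).integrable_mul (hH2 n)) (hE.const_mul _) fun x => ?_
      simp only
      rw [← sq, ← mul_pow, ← sq_abs]
      exact pow_le_pow_left₀ (abs_nonneg _) (hD n x) 2

/-- The function `w(x, t) = ∑ F n x * cas n t` built from line profiles with `F n 0 = a n`, where
`∑ n² (a n)² < ∞`: it lies in `H¹`, is continuous, decays exponentially, has trace `∑ a n cas n`,
and `g wₜₜ - wₓₓ` is the distribution `-2 ∑ q n cas n ⊗ δ₀`. -/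
theorem exists_wave {g : ℝ → ℝ} {ω M A : ℝ} (hρ : 0 < ρ) (hg : MemLp g ∞ volume)
    (hω : 2 * Real.pi / T = ω) {F G : ℤ → ℝ → ℝ} {a q : ℤ → ℝ}
    (hp : ∀ n : ℤ, IsLineProfile g ((n * ω) ^ 2) ρ (a n) (q n) (|a n| * M)
      (|a n| * (A * |(n : ℝ)|)) (F n) (G n))
    (h0 : a 0 = 0) (ha : Summable fun n : ℤ => ((n : ℝ) * a n) ^ 2) :
    ∃ w wx wt : ℝ × ℝ → ℝ, Continuous w ∧ (∀ x t, w (x, t + T) = w (x, t)) ∧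
      HasH1Derivs T w wx wt ∧ IsTraceAtZero T w wx (fun t => w (0, t)) ∧
      (∃ C : ℝ, 0 < C ∧ ∀ x t : ℝ, |w (x, t)| ≤ C * Real.exp (-ρ * |x|)) ∧
      (∀ η : ℝ → ℝ, Continuous η →
        HasSum (fun n => a n * ∫ t in Ioc 0 T, casLine T n t * η t)
          (∫ t in Ioc 0 T, w (0, t) * η t)) ∧
      ∀ ψ, IsTestFunction T ψ →
        HasSum (fun n => -(2 * q n * ∫ t in Ioc 0 T, casLine T n t * ψ (0, t)))
          (∫ p in strip T, (-(g p.1) * wt p * dt ψ p + wx p * dx ψ p)) := by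
  have hT0 := hT.out.le
  have hsa := summable_abs_of_summable_mul_sq h0 ha
  have hc : Summable fun n => |a n| * M * 2 := (hsa.mul_right M).mul_right 2
  set B : ℝ × ℝ → ℝ := fun p => Real.exp (-ρ * |p.1|) with hB
  have hB2 : MemLp B 2 (volume.restrict (strip T)) := by
    simpa [hB] using memLp_prod_mul (memLp_exp_neg_mul_abs hρ)
      (memLp_Ioc_of_continuous (T := T) (continuous_const (y := (1 : ℝ))) 2)
  set f : ℤ → ℝ × ℝ → ℝ := fun n p => F n p.1 * casLine T n p.2 with hf
  have hfc : ∀ n, Continuous (f n) := fun n =>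
    ((hp n).continuous.comp continuous_fst).mul ((continuous_casLine n).comp continuous_snd)
  have hfb : ∀ n p, |f n p| ≤ |a n| * M * 2 * B p := fun n p => by
    simp only [hf, hB]
    rw [abs_mul]
    calc |F n p.1| * |casLine T n p.2| ≤ |a n| * M * Real.exp (-ρ * |p.1|) * 2 :=
          mul_le_mul ((hp n).bound p.1) (abs_casLine_le _ _) (abs_nonneg _)
            ((abs_nonneg _).trans ((hp n).bound p.1))
      _ = _ := by ring
  have hB1 : ∀ p, B p ≤ 1 := fun p => by
    simp only [hB]
    rw [Real.exp_le_one_iff]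
    nlinarith [abs_nonneg p.1]
  have hB0 : ∀ p, 0 < B p := fun p => Real.exp_pos _
  have hcn : ∀ n, 0 ≤ |a n| * M * 2 := fun n =>
    nonneg_of_mul_nonneg_left ((abs_nonneg _).trans (hfb n 0)) (hB0 0)
  set w : ℝ × ℝ → ℝ := fun p => ∑' n, f n p with hw
  have hwc : Continuous w := by
    refine continuous_tsum hfc hc fun n p => ?_
    rw [Real.norm_eq_abs]
    exact (hfb n p).trans (mul_le_of_le_one_right (hcn n) (hB1 p))
  have hwb : ∀ p, |w p| ≤ (∑' n, |a n| * M * 2) * B p := fun p => by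
    rw [← Real.norm_eq_abs]
    exact tsum_of_norm_bounded (hc.hasSum.mul_right (B p)) fun n => hfb n p
  have hw2 : MemLp w 2 (volume.restrict (strip T)) :=
    (hB2.const_mul _).mono' hwc.aestronglyMeasurable (Eventually.of_forall hwb)
  have hwsum : ∀ φ, MemLp φ 2 (volume.restrict (strip T)) →
      HasSum (fun n => ∫ p in strip T, f n p * φ p) (∫ p in strip T, w p * φ p) := fun φ hφ =>
    hasSum_integral_tsum_mul (fun n => (hfc n).aestronglyMeasurable) hc hfb hB2 hφ
  obtain ⟨wx, hwx, hwxs⟩ := exists_superposition (T := T) hρ (σ := id) Function.injective_id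
    (fun n => (hp n).measurable.aestronglyMeasurable) (fun n => (hp n).bound_deriv) (by
      refine (ha.mul_right (A ^ 2)).congr fun n => ?_
      rw [mul_pow, mul_pow, mul_pow, sq_abs, sq_abs]
      ring)
  obtain ⟨wt, hwt, hwts⟩ := exists_superposition (T := T) hρ (σ := fun n => -n) neg_injective
    (H := fun n x => n * ω * F n x) (D := fun n => |n * ω| * (|a n| * M))
    (fun n => ((hp n).continuous.const_mul _).aestronglyMeasurable)
    (fun n x => by
      rw [abs_mul, mul_assoc]
      exact mul_le_mul_of_nonneg_left ((hp n).bound x) (abs_nonneg _)) (by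
      refine (ha.mul_right ((ω * M) ^ 2)).congr fun n => ?_
      rw [mul_pow, mul_pow, mul_pow |(n : ℝ) * ω|, mul_pow |a n|, sq_abs, sq_abs]
      ring)
  have hderiv : ∀ (n : ℤ) t, HasDerivAt (casLine T n) (n * ω * casLine T (-n) t) t := fun n t => by
    refine (hasDerivAt_casLine n t).congr_deriv ?_
    rw [hω]
    ring
  have hF2 := fun n => (hp n).memLp hρ
  refine ⟨w, wx, wt, hwc, fun x t => ?_, ⟨hw2, hwx, hwt, fun ψ hψ => ?_, fun ψ hψ => ?_⟩,
    ⟨?_, fun ψ hψ => ?_⟩, ?_, fun η hη => ?_, fun ψ hψ => ?_⟩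
  · simp only [hw, hf, casLine_add_period]
  · refine (hwsum _ hψ.memLp_dx).unique ?_
    refine ((hwxs ψ hψ.memLp).neg).congr_fun fun n => ?_
    exact (hp n).strip_weak_x hρ hψ (continuous_casLine n)
  · refine (hwsum _ hψ.memLp_dt).unique ?_
    refine ((hwts ψ hψ.memLp).neg).congr_fun fun n => ?_
    simp only [hf]
    rw [integral_strip_mul_dt hT0 hψ (hF2 n) (hderiv n)
      ((continuous_casLine (-n)).const_mul _) (casLine_period n)]
    congr 1
    refine integral_congr_ae (Eventually.of_forall fun p => ?_)
    simp only
    ring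
  · exact memLp_Ioc_of_continuous (hwc.comp (by fun_prop)) 2
  · have hS : MeasurableSet (Ioi (0 : ℝ) ×ˢ Ioc 0 T) := measurableSet_Ioi.prod measurableSet_Ioc
    have hsub : Ioi (0 : ℝ) ×ˢ Ioc 0 T ⊆ strip T := prod_mono (subset_univ _) le_rfl
    have hm := Measure.restrict_mono hsub (le_refl (volume : Measure (ℝ × ℝ)))
    have s1 := hwxs _ (hψ.memLp.indicator hS)
    have s2 := hwsum _ (hψ.memLp_dx.indicator hS)
    simp only [integral_strip_mul_indicator hS hsub] at s1 s2
    have e := integral_add ((hwx.integrable_mul hψ.memLp).mono_measure hm)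
      ((hw2.integrable_mul hψ.memLp_dx).mono_measure hm)
    simp only [Pi.mul_apply] at e
    rw [e]
    refine (s1.add s2).unique ?_
    have hψ0 : Continuous fun t => ψ (0, t) := hψ.smooth.continuous.comp (by fun_prop)
    have s3 := hasSum_integral_tsum_mul (μ := volume.restrict (Ioc 0 T))
      (f := fun n t => f n (0, t)) (B := fun t => B (0, t)) (φ := fun t => ψ (0, t))
      (fun n => ((hfc n).comp (by fun_prop)).aestronglyMeasurable) hc (fun n t => hfb n (0, t))
      (memLp_Ioc_of_continuous (by fun_prop) 2) (memLp_Ioc_of_continuous hψ0 2)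
    refine s3.neg.congr_fun fun n => ?_
    have := (hp n).strip_trace hρ hψ (continuous_casLine (T := T) n)
    simp only [hf, id]
    rw [this, ← integral_const_mul]
    congr 1
    refine integral_congr_ae (Eventually.of_forall fun t => ?_)
    simp only
    rw [(hp n).apply_zero]
    ring
  · have hC : 0 ≤ ∑' n, |a n| * M * 2 := tsum_nonneg hcn
    refine ⟨(∑' n, |a n| * M * 2) + 1, by linarith, fun x t => (hwb (x, t)).trans ?_⟩
    exact mul_le_mul_of_nonneg_right (by linarith) (hB0 (x, t)).le
  · have s3 := hasSum_integral_tsum_mul (μ := volume.restrict (Ioc 0 T))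
      (f := fun n t => f n (0, t)) (B := fun t => B (0, t)) (φ := η)
      (fun n => ((hfc n).comp (by fun_prop)).aestronglyMeasurable) hc (fun n t => hfb n (0, t))
      (memLp_Ioc_of_continuous (by fun_prop) 2) (memLp_Ioc_of_continuous hη 2)
    refine s3.congr_fun fun n => ?_
    simp only [hf]
    rw [(hp n).apply_zero, ← integral_const_mul]
    refine integral_congr_ae (Eventually.of_forall fun t => ?_)
    simp only
    ring
  · have hg' : MemLp (fun p : ℝ × ℝ => -(g p.1)) ∞ (volume.restrict (strip T)) := by
      rw [restrict_strip_univ]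
      exact hg.neg.comp_fst _
    have hgψ : MemLp (fun p => -(g p.1) * dt ψ p) 2 (volume.restrict (strip T)) :=
      MemLp.mul' hψ.memLp_dt hg'
    have e : ∫ p in strip T, (-(g p.1) * wt p * dt ψ p + wx p * dx ψ p) =
        (∫ p in strip T, wt p * (-(g p.1) * dt ψ p)) + ∫ p in strip T, wx p * dx ψ p := by
      rw [← integral_add (by exact hwt.integrable_mul hgψ)
        (by exact hwx.integrable_mul hψ.memLp_dx)]
      refine integral_congr_ae (Eventually.of_forall fun p => ?_)
      simp only
      ring
    rw [e]
    refine ((hwts _ hgψ).add (hwxs _ hψ.memLp_dx)).congr_fun fun n => ?_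
    have hd : ∀ t, HasDerivAt (fun t => n * ω * casLine T (-n) t)
        (-(n * ω) ^ 2 * casLine T n t) t := fun t => by
      have := (hderiv (-n) t).const_mul (n * ω)
      refine this.congr_deriv ?_
      rw [neg_neg]
      push_cast
      ring
    rw [← (hp n).weak_form hρ hg hT0 hψ (continuous_casLine n) hd (by rw [casLine_period])]
    congr 1
    refine integral_congr_ae (Eventually.of_forall fun p => ?_)
    simp only
    ring

end Assembly

/-! ### Solutions of the nonlinear equation -/

section Breathers

/-- The profiles of all odd modes, with derivatives at `0` growing at most linearly; for the given
`k₀` the profile is built from the given solution `φ₀`. -/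
theorem exists_lineProfiles {g : ℝ → ℝ} {ω ρ M : ℝ} (hg : MemLp g ∞ volume)
    (hg_even : ∀ᵐ x : ℝ, g (-x) = g x)
    (hspec : ∀ k : ℕ, Odd k → (0 : ℂ) ∉ spectrum (dirichletL g ω k))
    (hρ : 0 < ρ)
    (hdecay : ∀ k : ℕ, Odd k → ∀ φ : ℝ → ℝ, IsDecayingSolution g ω k φ →
      ∀ x : ℝ, 0 ≤ x → |φ x| ≤ M * Real.exp (-ρ * x))
    {k₀ : ℕ} {φ₀ : ℝ → ℝ} (hφ₀ : IsDecayingSolution g ω k₀ φ₀) :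
    ∃ (A : ℝ) (F G : ℕ → ℝ → ℝ) (p : ℕ → ℝ), 0 ≤ A ∧
      p k₀ = derivWithin φ₀ (Ici 0) 0 ∧
      ∀ k : ℕ, Odd k → |p k| ≤ A * k ∧
        IsLineProfile g ((k : ℝ) ^ 2 * ω ^ 2) ρ 1 (p k) M (A * k) (F k) (G k) := by
  obtain ⟨N, hN0, hN⟩ := ae_abs_le_of_memLp_top hg
  have hex : ∀ k : ℕ, ∃ φ : ℝ → ℝ, (k = k₀ → φ = φ₀) ∧ (Odd k → IsDecayingSolution g ω k φ) := by
    intro k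
    by_cases hk : k = k₀
    · exact ⟨φ₀, fun _ => rfl, fun _ => hk ▸ hφ₀⟩
    · by_cases hodd : Odd k
      · obtain ⟨φ, hφ⟩ := exists_isDecayingSolution hg hg_even (hspec k hodd)
        exact ⟨φ, fun h => absurd h hk, fun _ => hφ⟩
      · exact ⟨0, fun h => absurd h hk, fun h => absurd h hodd⟩
  choose φ hφ hdec using hex
  have hprof : ∀ k : ℕ, ∃ φ' : ℝ → ℝ, Odd k → ∃ φ'',
      IsProfile g ((k : ℝ) ^ 2 * ω ^ 2) ρ M ((2 * M + ω ^ 2 * N * M) * k) (φ k) φ' φ'' ∧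
        derivWithin (φ k) (Ici 0) 0 = φ' 0 := by
    intro k
    by_cases hodd : Odd k
    · obtain ⟨φ', φ'', h⟩ := (hdec k hodd).exists_isProfile hρ hodd.pos hN0 hN
        (hdecay k hodd _ (hdec k hodd))
      exact ⟨φ', fun _ => ⟨φ'', h⟩⟩
    · exact ⟨0, fun h => absurd h hodd⟩
  choose φ' hφ' using hprof
  have hM0 : 0 ≤ M := by
    have h1 : Odd 1 := odd_one
    have := (abs_nonneg _).trans (hdecay 1 h1 _ (hdec 1 h1) 0 le_rfl)
    simpa using this
  refine ⟨2 * M + ω ^ 2 * N * M, fun k x => φ k |x|, fun k x => sgn x * φ' k |x|,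
    fun k => derivWithin (φ k) (Ici 0) 0, by positivity,
    congrArg (derivWithin · (Ici 0) 0) (hφ k₀ rfl), fun k hodd => ?_⟩
  obtain ⟨φ'', h, h0⟩ := hφ' k hodd
  simp only [h0]
  refine ⟨?_, h.isLineProfile hρ hg hg_even⟩
  simpa using h.bound_fst 0 le_rfl

theorem tendsto_cofinite_of_le_div {c : ℤ → ℝ} {K : ℝ} (h : ∀ n : ℤ, |c n| ≤ K / |(n : ℝ)|) :
    Tendsto c cofinite (nhds 0) := by
  have h1 : Tendsto (fun n : ℤ => |(n : ℝ)|) cofinite atTop :=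
    (tendsto_norm_cocompact_atTop (E := ℝ)).comp Int.tendsto_coe_cofinite
  exact squeeze_zero_norm h (tendsto_const_nhds.div_atTop h1)

/-- From a minimizer `z = ∂ₜ w(0, ·)` of the reduced functional with entries
`c n = Φₙ'(0) / (γ n² ω²)` to the solution `w` of the equation. -/
theorem exists_weakSolution_of_lineProfiles {g : ℝ → ℝ} {ω γ ρ M A T : ℝ} [hT : Fact (0 < T)]
    (hω : 2 * Real.pi / T = ω) (hω0 : 0 < ω) (hγ : γ ≠ 0) (hρ : 0 < ρ) (hg : MemLp g ∞ volume)
    {F G : ℕ → ℝ → ℝ} {p : ℕ → ℝ} (hA : 0 ≤ A)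
    (hp : ∀ k : ℕ, Odd k → |p k| ≤ A * k ∧
      IsLineProfile g ((k : ℝ) ^ 2 * ω ^ 2) ρ 1 (p k) M (A * k) (F k) (G k))
    {k₀ : ℕ} (hk₀ : Odd k₀) (hneg : p k₀ / γ < 0) :
    ∃ w : ℝ × ℝ → ℝ, IsWeakSolution g γ T w ∧ ¬ w =ᵐ[volume] 0 ∧
      ∃ C : ℝ, 0 < C ∧ ∀ x t : ℝ, |w (x, t)| ≤ C * Real.exp (-ρ * |x|) := by
  classical
  set c : ℤ → ℝ := fun n => if Odd n then p n.natAbs / (γ * (n * ω) ^ 2) else 0 with hc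
  have hcodd : ∀ n, Odd n → c n = p n.natAbs / (γ * (n * ω) ^ 2) := fun n hn => if_pos hn
  have hceven : ∀ n, Even n → c n = 0 := fun n hn => if_neg (Int.not_odd_iff_even.2 hn)
  have hne : ∀ {n : ℤ}, Odd n → (n : ℝ) ≠ 0 := fun {n} hn => by
    have : n ≠ 0 := by
      rintro rfl
      exact (by decide : ¬ Odd (0 : ℤ)) hn
    exact_mod_cast this
  have hcle : ∀ n : ℤ, |c n| ≤ A / (|γ| * ω ^ 2) / |(n : ℝ)| := fun n => by
    by_cases hn : Odd n
    · rw [hcodd n hn, abs_div, abs_mul, abs_of_nonneg (sq_nonneg ((n : ℝ) * ω)), mul_pow,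
        ← sq_abs (n : ℝ)]
      have h1 := (hp _ (Int.natAbs_odd.2 hn)).1
      rw [Nat.cast_natAbs, Int.cast_abs] at h1
      have h2 : 0 < |(n : ℝ)| := abs_pos.2 (hne hn)
      have h3 : 0 < |γ| := abs_pos.2 hγ
      rw [div_div, div_le_div_iff₀ (by positivity) (by positivity)]
      calc |p n.natAbs| * (|γ| * ω ^ 2 * |(n : ℝ)|)
          ≤ A * |(n : ℝ)| * (|γ| * ω ^ 2 * |(n : ℝ)|) := by gcongr
        _ = _ := by ring
    · rw [hceven n (Int.not_odd_iff_even.1 hn), abs_zero]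
      positivity
  have hk₀' : Odd (k₀ : ℤ) := by exact_mod_cast hk₀
  have hcneg : c k₀ < 0 := by
    have h1 : ((k₀ : ℤ) : ℝ) ≠ 0 := hne hk₀'
    rw [hcodd _ hk₀', Int.natAbs_natCast, ← div_div]
    exact div_neg_of_neg_of_pos hneg (by positivity)
  obtain ⟨z, hz4, hanti, hz0, hEL⟩ := exists_critical_point (T := T) c
    (tendsto_cofinite_of_le_div hcle) hk₀' hcneg
  have hz2 := memLp_two_of_memLp_four hz4
  have hzeven : ∀ n : ℤ, Even n → casCoeff z n = 0 := fun n hn => casCoeff_eq_zero_of_even hn hanti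
  -- these are the coefficients of the antiderivative of `z`, as `cas n` has derivative
  -- `n ω cas (-n)`; for even `n`, including the division by zero at `n = 0`, they vanish
  set a : ℤ → ℝ := fun n => casCoeff z (-n) / (n * ω) with ha
  have haeven : ∀ n : ℤ, Even n → a n = 0 := fun n hn => by
    simp only [ha]
    rw [hzeven _ hn.neg, zero_div]
  have hamul : ∀ n : ℤ, a n * (n * ω) = casCoeff z (-n) := fun n => by
    rcases Int.even_or_odd n with hn | hn
    · rw [haeven n hn, hzeven _ hn.neg, zero_mul]
    · have := hne hn
      simp only [ha]
      field_simp
  have hasum : Summable fun n : ℤ => ((n : ℝ) * a n) ^ 2 := by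
    have h1 := (hasSum_casCoeff_mul hz2 hz2).summable
    have h2 := ((Equiv.neg ℤ).summable_iff.2 h1).mul_right ((ω ^ 2)⁻¹)
    refine h2.congr fun n => ?_
    simp only [Function.comp_apply, Equiv.neg_apply]
    rw [← hamul n]
    field_simp
  obtain ⟨w, wx, wt, hwc, hper, hH1, htr, hbd, htrace, hweak⟩ := exists_wave (T := T) (M := M)
    (A := A) (F := fun n x => a n * (if Odd n then F n.natAbs x else 0))
    (G := fun n x => a n * (if Odd n then G n.natAbs x else 0)) (a := a)
    (q := fun n => a n * p n.natAbs) hρ hg hω (fun n => by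
      by_cases hn : Odd n
      · have h1 := (hp _ (Int.natAbs_odd.2 hn)).2.const_mul (a n)
        rw [mul_one, Nat.cast_natAbs, Int.cast_abs, sq_abs, ← mul_pow] at h1
        simpa only [if_pos hn] using h1
      · simpa [haeven n (Int.not_odd_iff_even.1 hn)] using
          IsLineProfile.zero g ((n * ω) ^ 2) ρ) (haeven 0 (by decide)) hasum
  have hcas : ∀ η η' : ℝ → ℝ, (∀ t, HasDerivAt η (η' t) t) → Continuous η' → η T = η 0 →
      ∀ n : ℤ, ∫ t in Ioc 0 T, casLine T n t * η' t =
        -(n * ω * ∫ t in Ioc 0 T, casLine T (-n) t * η t) := fun η η' hη hη' hηT n => by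
    have hd : ∀ t, HasDerivAt (casLine T n) (n * ω * casLine T (-n) t) t := fun t => by
      refine (hasDerivAt_casLine n t).congr_deriv ?_
      rw [hω]
      ring
    rw [integral_Ioc_mul_deriv hT.out.le hd ((continuous_casLine _).const_mul _)
      (casLine_period n) hη hη' hηT, ← integral_const_mul]
    simp only [mul_assoc]
  have hwd : IsWeakDerivTorus T (fun t => w (0, t)) fun t => z t := by
    intro η hη hηper
    have hη1 : ∀ t, HasDerivAt η (deriv η t) t := fun t =>
      (hη.differentiable (by simp) t).hasDerivAt
    have hη' : Continuous (deriv η) := hη.continuous_deriv (by simp)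
    obtain ⟨H, hH⟩ := exists_continuousMap_of_periodic hη.continuous hηper
    have hH2 := memLp_continuousMap H 2
    have s1 := htrace _ hη'
    have s2 := ((Equiv.neg ℤ).hasSum_iff.2 (hasSum_casCoeff_mul hz2 hH2)).mul_left (-T)
    have e : ∫ t in Ioc 0 T, z t * η t = T * ∫ x, z x * H x ∂haarAddCircle := by
      rw [← integral_Ioc_coe]
      simp only [hH]
    rw [e, ← neg_mul]
    refine s1.unique (s2.congr_fun fun n => ?_)
    rw [hcas η _ hη1 hη' (by simpa using hηper 0)]
    have e2 := integral_casLine_mul (T := T) (H := H) (-n)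
    simp only [hH] at e2
    rw [e2]
    simp only [Function.comp_apply, Equiv.neg_apply]
    rw [← hamul n]
    ring
  refine ⟨w, ⟨hper, wx, wt, fun t => w (0, t), fun t => z t, hH1, htr, hwd, ?_, fun ψ hψ => ?_⟩,
    fun h0 => hz0 ?_, hbd⟩
  · exact memLp_coe (hz4.mono_exponent (by norm_num))
  · have hη1 : ∀ t, HasDerivAt (fun t => ψ (0, t)) (dt ψ (0, t)) t := hψ.hasDerivAt_dt 0
    have hη' : Continuous fun t => dt ψ (0, t) := hψ.continuous_dt.comp (by fun_prop)
    have hηper : ∀ t, dt ψ (0, t + T) = dt ψ (0, t) := fun t => by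
      have h1 := ((hη1 (t + T)).comp_add_const t T)
      simp only [hψ.periodic] at h1
      exact h1.unique (hη1 t)
    obtain ⟨H, hH⟩ := exists_continuousMap_of_periodic hη' hηper
    have e1 : ∫ t in Ioc 0 T, z t ^ 3 * dt ψ (0, t) = T * ∫ x, z x ^ 3 * H x ∂haarAddCircle := by
      rw [← integral_Ioc_coe]
      simp only [hH]
    -- both sides become series over `n`, matched after the substitution `n ↦ -n`
    rw [e1, integral_cube_mul_eq hceven hz4 hanti hEL (memLp_continuousMap H 4), sub_eq_zero,
      ← (hweak ψ hψ).tsum_eq, ← (Equiv.neg ℤ).tsum_eq, ← tsum_mul_left, ← tsum_neg,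
      ← tsum_mul_left, ← tsum_mul_left]
    refine tsum_congr fun n => ?_
    simp only [Equiv.neg_apply]
    have e2 := integral_casLine_mul (T := T) (H := H) n
    simp only [hH] at e2
    rw [hcas _ _ hη1 hη' (by simpa using hψ.periodic 0 0)] at e2
    rcases Int.even_or_odd n with hn | hn
    · rw [hceven n hn, haeven _ hn.neg]
      simp
    · have h1 := hne hn
      have e3 := hamul (-n)
      rw [neg_neg] at e3
      rw [hcodd n hn, ← e3, Int.natAbs_neg]
      push_cast
      have e4 : T * casCoeff H n = -(n * ω * ∫ t in Ioc 0 T, casLine T (-n) t * ψ (0, t)) := e2.symm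
      set I := ∫ t in Ioc 0 T, casLine T (-n) t * ψ (0, t)
      have e5 : γ * (T * -(2 * (p n.natAbs / (γ * (n * ω) ^ 2) * (a (-n) * (-n * ω) *
          casCoeff H n)))) = -(2 * (p n.natAbs / (n * ω) * -a (-n) * (T * casCoeff H n))) := by
        field_simp
      rw [e5, e4]
      field_simp
  · have hw0 : w = 0 := (Continuous.ae_eq_iff_eq volume hwc continuous_zero).1 h0
    -- `z` is the weak derivative of the trace of `w = 0`
    have hzero : ∀ n : ℤ, casCoeff z n = 0 := fun n => by
      have h1 := hwd _ (contDiff_casLine n) (casLine_add_period n)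
      simp only [hw0, Pi.zero_apply, zero_mul, integral_zero] at h1
      have h2 := integral_casLine_mul (T := T) (H := z) n
      simp only [mul_comm (casLine T n _)] at h2
      rw [h2] at h1
      have h3 := hT.out.ne'
      rcases mul_eq_zero.1 (neg_eq_zero.1 h1.symm) with h | h
      · exact absurd h h3
      · exact h
    have h1 := eq_zero_of_integral_cas_mul (hz2.toLp z) fun n => by
      rw [← hzero n, casCoeff]
      refine integral_congr_ae ?_
      filter_upwards [hz2.coeFn_toLp] with x hx
      rw [hx]
    rw [Lp.eq_zero_iff_ae_eq_zero] at h1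
    exact hz2.coeFn_toLp.symm.trans h1

end Breathers

end Breather

theorem mainTheorem1 (g : ℝ → ℝ) (ω γ ρ M : ℝ)
    -- the basic assumption on the coefficients and the frequency
    (hω : 0 < ω)
    (hg : MemLp g ∞ volume)
    (hg_even : ∀ᵐ x : ℝ, g (-x) = g x)
    (hg_ne : ¬ g =ᵐ[volume] 0)
    -- the spectral condition
    (hspec : ∀ k : ℕ, Odd k →
      (0 : ℂ) ∉ Breather.essentialSpectrum (Breather.operatorL g ω k) ∪
        Breather.spectrum (Breather.dirichletL g ω k))
    -- the uniform exponential decay of the functions `Φ_k`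
    (hρ : 0 < ρ) (hM : 0 < M)
    (hdecay : ∀ k : ℕ, Odd k → ∀ φ : ℝ → ℝ, Breather.IsDecayingSolution g ω k φ →
      ∀ x : ℝ, 0 ≤ x → |φ x| ≤ M * Real.exp (-ρ * x))
    -- the sign condition on `γ` and one of the numbers `Φ_k'(0)`
    (hsign :
      (γ < 0 ∧ ∃ k : ℕ, Odd k ∧ ∃ φ : ℝ → ℝ, Breather.IsDecayingSolution g ω k φ ∧
        0 < derivWithin φ (Set.Ici 0) 0) ∨
      (0 < γ ∧ ∃ k : ℕ, Odd k ∧ ∃ φ : ℝ → ℝ, Breather.IsDecayingSolution g ω k φ ∧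
        derivWithin φ (Set.Ici 0) 0 < 0)) :
    ∃ w : ℝ × ℝ → ℝ,
      Breather.IsWeakSolution g γ (2 * Real.pi / ω) w ∧
      ¬ w =ᵐ[volume] 0 ∧
      ∃ C : ℝ, 0 < C ∧ ∀ x t : ℝ, |w (x, t)| ≤ C * Real.exp (-ρ * |x|) := by
  have hT : Fact (0 < 2 * Real.pi / ω) := ⟨by positivity⟩
  have hTω : 2 * Real.pi / (2 * Real.pi / ω) = ω := by
    have := Real.pi_pos.ne'
    field_simp
  obtain ⟨k, hk, φ, hφ, hγ, hneg⟩ : ∃ k : ℕ, Odd k ∧ ∃ φ : ℝ → ℝ,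
      Breather.IsDecayingSolution g ω k φ ∧ γ ≠ 0 ∧ derivWithin φ (Set.Ici 0) 0 / γ < 0 := by
    rcases hsign with ⟨hγ, k, hk, φ, hφ, h⟩ | ⟨hγ, k, hk, φ, hφ, h⟩
    · exact ⟨k, hk, φ, hφ, hγ.ne, div_neg_of_pos_of_neg h hγ⟩
    · exact ⟨k, hk, φ, hφ, hγ.ne', div_neg_of_neg_of_pos h hγ⟩
  obtain ⟨A, F, G, p, hA, hpk, hp⟩ := Breather.exists_lineProfiles hg hg_even
    (fun k hk h => hspec k hk (Or.inr h)) hρ hdecay hφ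
  exact Breather.exists_weakSolution_of_lineProfiles hTω hω hγ hρ hg hA hp hk (hpk ▸ hneg)
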